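/- Let $\mathbb K$ be an infinite field and $R=\mathbb K[x_0,\dots,x_n]$ with its standard grading and $x_0<\dots<x_n$. For a $\mathbb K$-algebra $A$ write $R_A=A[x_0,\dots,x_n]$, and write again $I$ for the extension $I\cdot R_A$ of an ideal $I\subseteq R$. For an ideal $I$ let $I_s$ be its part of degree $s$, $I_{\ge t}=\bigoplus_{s\ge t}I_s$, and, if $I$ is monomial, let $\mathcal N(I)$ be the set of terms not in $I$. Let $\operatorname{reg}$ denote Castelnuovo–Mumford regularity. The Pommaret cone of a term $x^\alpha$ is the set of all $x^\delta x^\alpha$ such that $x^\delta$ involves only variables $x_i\le\min(x^\alpha)$, where $\min(x^\alpha)$ is the smallest variable dividing $x^\alpha$ (no condition if $x^\alpha=1$). An ideal of $R$ is quasi-stable if it is generated by a finite set of terms, its (unique) Pommaret basis, whose Pommaret cones are pairwise disjoint and cover exactly the terms of the ideal; the Pommaret basis of a quasi-stable ideal $I$ is denoted $\mathcal P_I$. For quasi-stable ideals $I\subseteq I'$ of $R$, a $\mathcal P_{I'}$-marked basis relative to $I$ over $A$ is a set $H=\{h_\alpha \mid x^\alpha\in\mathcal P_{I'}\setminus\mathcal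 P_{I}\}\subset R_A$ of homogeneous polynomials such that $h_\alpha-x^\alpha\in\langle\mathcal N(I')\rangle_A$ for all $\alpha$ and such that, with $J_H=(\mathcal P_I\cup H)\subseteq R_A$, the graded decomposition $$R_A=I\oplus\bigl(\langle\mathcal N(I)\rangle_A\cap J_H\bigr)\oplus\langle\mathcal N(I')\rangle_A$$ holds; $\underline{\mathrm{Mf}}_{I,I'}(A)$ is the set of the ideals $J_H$ for all such $H$. Let $\tilde I\subseteq R$ be a saturated quasi-stable ideal such that $R/\tilde I$ is Cohen–Macaulay, and let $x_{k+1},\dots,x_n$ be the variables that divide some minimal monomial generator of $\tilde I$. Let $\mathbb L/\mathbb K$ be a field extension, put $S=R_{\mathbb L}/\tilde I R_{\mathbb L}$, let $J\subseteq R_{\mathbb L}$ be a saturated homogeneous ideal containing $\tilde I$, and let $t\ge 0$ be an integer with $t\ge\max\{\operatorname{reg}(J),\operatorname{reg}(\tilde I)\}$. Then there are an invertible matrix $g=(g_{jl})_{0\le j,l\le k}$ over $\mathbb K$ and a saturated quasi-stable ideal $\tilde J\subseteq R$ containing $\tilde I$ with the following property. Let $\tilde g$ be the automorphism of $S$ induced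 by the coordinate change $x_j\mapsto\sum_{l=0}^k g_{jl}x_l$ for $j\le k$ and $x_i\mapsto x_i$ for $i>k$. Then the ideal of $S$ generated by $\tilde g(J_t)$ (the image under $\tilde g$ of the residue classes of the elements of $J_t$) is generated by the image in $S$ of a $\mathcal P_{\tilde J_{\ge t}}$-marked basis $H\subset R_{\mathbb L}$ relative to $\tilde I_{\ge t}$; in particular $(\mathcal P_{\tilde I_{\ge t}}\cup H)\in\underline{\mathrm{Mf}}_{\tilde I_{\ge t},\tilde J_{\ge t}}(\mathbb L)$. -/

import Mathlib

open MvPolynomial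

attribute [local instance] MvPolynomial.gradedAlgebra

/-! ### Cohen-Macaulay rings -/

/-- A local ring is Cohen-Macaulay if its maximal ideal contains a regular sequence whose length is
the Krull dimension of the ring. -/
def IsCohenMacaulayLocal (A : Type*) [CommRing A] [IsLocalRing A] : Prop :=
  ∃ rs : List A, (∀ r ∈ rs, r ∈ IsLocalRing.maximalIdeal A) ∧
    RingTheory.Sequence.IsRegular A rs ∧ (rs.length : WithBot ℕ∞) = ringKrullDim A

/-- A Noetherian ring all of whose local rings are Cohen-Macaulay. -/
def IsCohenMacaulayRing (A : Type*) [CommRing A] : Prop :=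
  IsNoetherianRing A ∧
    ∀ (p : Ideal A) [p.IsPrime], IsCohenMacaulayLocal (Localization.AtPrime p)

namespace RelMarked

/-- The polynomial ring `A[x_0, …, x_n]`, with the variables ordered by `x_0 < ⋯ < x_n`. -/
abbrev Poly (n : ℕ) (A : Type*) [CommRing A] := MvPolynomial (Fin (n + 1)) A

/-- The terms (power products) in `x_0, …, x_n`, given by their exponent vectors. -/
abbrev Term (n : ℕ) := Fin (n + 1) →₀ ℕ

/-- The term with exponent vector `α`, as a polynomial over `A`. -/
noncomputable abbrev term {n : ℕ} (A : Type*) [CommRing A] (α : Term n) : Poly n A :=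
  monomial α 1

/-! ### Homogeneous and saturated ideals, truncations -/

/-- `J` is homogeneous for the standard grading. -/
def IsHomogeneousIdeal {n : ℕ} {A : Type*} [CommRing A] (J : Ideal (Poly n A)) : Prop :=
  J.IsHomogeneous (homogeneousSubmodule (Fin (n + 1)) A)

/-- `J` is saturated with respect to the irrelevant ideal `(x_0, …, x_n)`. -/
def IsSaturatedIdeal {n : ℕ} {A : Type*} [CommRing A] (J : Ideal (Poly n A)) : Prop :=
  ∀ (f : Poly n A) (s : ℕ),
    (∀ h ∈ (Ideal.span (Set.range (X : Fin (n + 1) → Poly n A))) ^ s, h * f ∈ J) → f ∈ J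

/-- The homogeneous component `J_t`. -/
def degPart {n : ℕ} {A : Type*} [CommRing A] (J : Ideal (Poly n A)) (t : ℕ) : Set (Poly n A) :=
  {f | f ∈ J ∧ f.IsHomogeneous t}

/-- The truncation `J_{≥ t}`. -/
noncomputable def truncGE {n : ℕ} {A : Type*} [CommRing A] (J : Ideal (Poly n A)) (t : ℕ) :
    Ideal (Poly n A) :=
  Ideal.span (⋃ s ≥ t, degPart J s)

/-- The extension `I · A[x_0, …, x_n]` of an ideal `I` of `K[x_0, …, x_n]`. -/
noncomputable def extend {n : ℕ} {K : Type*} [Field K] (A : Type*) [CommRing A] [Algebra K A]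
    (I : Ideal (Poly n K)) : Ideal (Poly n A) :=
  I.map (MvPolynomial.map (algebraMap K A))

/-! ### Castelnuovo-Mumford regularity, through Koszul homology -/

/-- The differential of the Koszul complex of `x_0, …, x_n`:
`f e_B ↦ ∑_{a ∈ B} (-1)^{#{b ∈ B | b < a}} x_a f e_{B \ {a}}`. -/
noncomputable def koszulD (n : ℕ) (K : Type*) [Field K] :
    (Finset (Fin (n + 1)) → Poly n K) →ₗ[K] (Finset (Fin (n + 1)) → Poly n K) where
  toFun c B := ∑ a ∈ Bᶜ, (-1 : Poly n K) ^ (B.filter (· < a)).card * (X a * c (insert a B))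
  map_add' c c' := by
    funext B
    simp [mul_add, Finset.sum_add_distrib]
  map_smul' r c := by
    funext B
    simp [Finset.smul_sum]

/-- The chains of homological degree `i` and internal degree `j` of the Koszul complex with
coefficients in `J` (the basis vector `e_B` has internal degree `#B`). -/
def koszulChains {n : ℕ} {K : Type*} [Field K] (J : Ideal (Poly n K)) (i j : ℕ) :
    Submodule K (Finset (Fin (n + 1)) → Poly n K) where
  carrier := {c | ∀ B, c B ∈ J ∧
    ∀ α, coeff α (c B) ≠ 0 → B.card = i ∧ α.degree + i = j}
  zero_mem' := by
    intro B
    simp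
  add_mem' := by
    intro c c' hc hc' B
    refine ⟨J.add_mem (hc B).1 (hc' B).1, fun α hα => ?_⟩
    by_cases h : coeff α (c B) = 0
    · refine (hc' B).2 α fun h' => hα ?_
      simp [h, h']
    · exact (hc B).2 α h
  smul_mem' := by
    intro r c hc B
    refine ⟨?_, fun α hα => (hc B).2 α fun h => hα ?_⟩
    · rw [Pi.smul_apply, MvPolynomial.smul_eq_C_mul]
      exact J.mul_mem_left _ (hc B).1
    · simp [h]

/-- `Tor_i(J, K)_j ≠ 0`, that is, the graded Betti number `β_{i,j}(J)` is nonzero: some Koszul cycle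
is not a boundary. -/
def BettiNonzero {n : ℕ} {K : Type*} [Field K] (J : Ideal (Poly n K)) (i j : ℕ) : Prop :=
  ¬ (koszulChains J i j ⊓ LinearMap.ker (koszulD n K) ≤
      (koszulChains J (i + 1) j).map (koszulD n K))

/-- The Castelnuovo-Mumford regularity `max {j - i | β_{i,j}(J) ≠ 0}` of a homogeneous ideal. It is
`0` for the zero ideal. Chains vanish for `j < i`, so the subtraction does not truncate. -/
noncomputable def reg {n : ℕ} {K : Type*} [Field K] (J : Ideal (Poly n K)) : ℕ∞ :=
  ⨆ (i : ℕ) (j : ℕ) (_ : BettiNonzero J i j), ((j - i : ℕ) : ℕ∞)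

/-! ### Quasi-stable ideals -/

/-- The Pommaret cone of `x^α`: the multiples of `x^α` by a term in variables that are not larger
than any variable dividing `x^α` (by any term at all, if `α = 0`). -/
def pommaretCone {n : ℕ} (α : Term n) : Set (Term n) :=
  {β | ∃ δ : Term n, β = δ + α ∧ ∀ i, δ i ≠ 0 → ∀ j, α j ≠ 0 → i ≤ j}

/-- The finite set of terms `U` is a Pommaret basis of the ideal `I`. -/
structure IsPommaretBasis {n : ℕ} {K : Type*} [Field K] (U : Finset (Term n))
    (I : Ideal (Poly n K)) : Prop where
  span_eq : Ideal.span (term K '' (U : Set (Term n))) = I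
  disjoint : (U : Set (Term n)).PairwiseDisjoint pommaretCone
  terms_eq : {α : Term n | term K α ∈ I} = ⋃ α ∈ U, pommaretCone α

/-- An ideal is quasi-stable if it has a Pommaret basis (in particular it is monomial). -/
def IsQuasiStable {n : ℕ} {K : Type*} [Field K] (I : Ideal (Poly n K)) : Prop :=
  ∃ U : Finset (Term n), IsPommaretBasis U I

/-- Pommaret bases are unique. -/
theorem IsPommaretBasis.unique {n : ℕ} {K : Type*} [Field K] {U V : Finset (Term n)}
    {I : Ideal (Poly n K)} (hU : IsPommaretBasis U I) (hV : IsPommaretBasis V I) : U = V := by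
  have self : ∀ α : Term n, α ∈ pommaretCone α := fun α => ⟨0, by simp, by simp⟩
  have trans : ∀ α β γ : Term n, α ∈ pommaretCone β → β ∈ pommaretCone γ →
      α ∈ pommaretCone γ := by
    rintro α β γ ⟨δ, rfl, hδ⟩ ⟨ε, rfl, hε⟩
    refine ⟨δ + ε, (add_assoc _ _ _).symm, fun i hi j hj => ?_⟩
    by_cases h : δ i = 0
    · exact hε i (by simpa [h] using hi) j hj
    · exact hδ i h j (by simp [hj])
  have anti : ∀ α β : Term n, α ∈ pommaretCone β → β ∈ pommaretCone α → α = β := by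
    rintro α β ⟨δ, h, -⟩ ⟨ε, h', -⟩
    exact le_antisymm (h' ▸ le_add_self) (h ▸ le_add_self)
  have key : ∀ {U V : Finset (Term n)}, IsPommaretBasis U I → IsPommaretBasis V I → U ⊆ V := by
    intro U V hU hV α hα
    have h1 : α ∈ {α : Term n | term K α ∈ I} := by
      rw [hU.terms_eq]
      exact Set.mem_biUnion hα (self α)
    rw [hV.terms_eq] at h1
    obtain ⟨β, hβ, hαβ⟩ := Set.mem_iUnion₂.1 h1
    have h2 : β ∈ {α : Term n | term K α ∈ I} := by
      rw [hV.terms_eq]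
      exact Set.mem_biUnion hβ (self β)
    rw [hU.terms_eq] at h2
    obtain ⟨γ, hγ, hβγ⟩ := Set.mem_iUnion₂.1 h2
    have h3 : α = γ := by
      by_contra hne
      exact Set.disjoint_left.1 (hU.disjoint hα hγ hne) (self α) (trans _ _ _ hαβ hβγ)
    subst h3
    rw [anti _ _ hαβ hβγ]
    exact hβ
  exact Finset.Subset.antisymm (key hU hV) (key hV hU)

/-- The monomial basis of a monomial ideal: the terms in the ideal that are minimal with respect to
divisibility. -/
def monomialBasis {n : ℕ} {K : Type*} [Field K] (I : Ideal (Poly n K)) : Set (Term n) :=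
  {α | Minimal (fun β : Term n => term K β ∈ I) α}

/-- `x_{k+1}, …, x_n` are exactly the variables that divide some minimal generator of `I`. -/
def IsLastFreeVar {n : ℕ} {K : Type*} [Field K] (I : Ideal (Poly n K)) (k : Fin (n + 1)) : Prop :=
  ∀ i, k < i ↔ ∃ α ∈ monomialBasis I, α i ≠ 0

/-- The set of terms outside of the ideal `I`. -/
def normalTerms {n : ℕ} {K : Type*} [Field K] (I : Ideal (Poly n K)) : Set (Term n) :=
  {α | term K α ∉ I}

/-! ### Relative marked bases -/

/-- The graded decomposition `A[x] = ⨁ i, M i`. -/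
def IsGradedDecomposition {n : ℕ} {A : Type*} [CommRing A] {ι : Type*} [DecidableEq ι]
    (M : ι → Submodule A (Poly n A)) : Prop :=
  DirectSum.IsInternal M ∧
    ∀ s : ℕ, ⨆ i, M i ⊓ homogeneousSubmodule (Fin (n + 1)) A s =
      homogeneousSubmodule (Fin (n + 1)) A s

/-- `(F α)_{α ∈ Q}` is a marked set over the Pommaret basis `Q` of the quasi-stable ideal `J`: `F α`
is homogeneous with head term `x^α`, whose coefficient is `1`, and all its other terms lie outside
of `J`. The values of `F` outside of `Q` play no role. -/
def IsMarkedSet {n : ℕ} {K : Type*} [Field K] {A : Type*} [CommRing A]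
    (J : Ideal (Poly n K)) (Q : Finset (Term n)) (F : Term n → Poly n A) : Prop :=
  ∀ α ∈ Q, (F α).IsHomogeneous α.degree ∧ coeff α (F α) = 1 ∧
    F α - term A α ∈ restrictSupport A (normalTerms J)

/-- `H` is a marked set over the Pommaret basis `Q` of `J` relative to the ideal with Pommaret basis
`P`: the part of a marked set that belongs to the head terms in `Q \ P`. -/
def IsRelMarkedSet {n : ℕ} {K : Type*} [Field K] {A : Type*} [CommRing A]
    (J : Ideal (Poly n K)) (P Q : Finset (Term n)) (H : Set (Poly n A)) : Prop :=
  ∃ F : Term n → Poly n A, IsMarkedSet J Q F ∧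
    H = F '' {α | α ∈ Q ∧ α ∉ P}

/-- The ideal of `A[x]` generated by `H` and the Pommaret basis `P`. -/
noncomputable def genIdeal {n : ℕ} {A : Type*} [CommRing A] (P : Finset (Term n))
    (H : Set (Poly n A)) : Ideal (Poly n A) :=
  Ideal.span (term A '' (P : Set (Term n)) ∪ H)

/-- `H ⊆ A[x]` is a marked basis over the Pommaret basis `Q` of `J` relative to `I`, where `I ⊆ J`
are quasi-stable ideals and `P` is the Pommaret basis of `I`. -/
structure IsRelMarkedBasis {n : ℕ} {K : Type*} [Field K] {A : Type*} [CommRing A] [Algebra K A]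
    (I J : Ideal (Poly n K)) (P Q : Finset (Term n)) (H : Set (Poly n A)) : Prop where
  le : I ≤ J
  basis_left : IsPommaretBasis P I
  basis_right : IsPommaretBasis Q J
  markedSet : IsRelMarkedSet J P Q H
  decomposition : IsGradedDecomposition
    ![(extend A I).restrictScalars A,
      restrictSupport A (normalTerms I) ⊓ (genIdeal P H).restrictScalars A,
      restrictSupport A (normalTerms J)]

/-- The value at the `K`-algebra `A` of the marked functor on `J` relative to `I`. -/
def relMarkedFunctor {n : ℕ} {K : Type*} [Field K] (A : Type*) [CommRing A] [Algebra K A]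
    (I J : Ideal (Poly n K)) : Set (Ideal (Poly n A)) :=
  {𝔞 | ∃ (P Q : Finset (Term n)) (H : Set (Poly n A)),
    IsRelMarkedBasis I J P Q H ∧ 𝔞 = genIdeal P H}

/-! ### Changes of the coordinates `x_0, …, x_k` -/

/-- The coordinate change `x_j ↦ ∑_{l ≤ k} g_{jl} x_l` for `j ≤ k`, and `x_i ↦ x_i` for `i > k`, on
`A[x_0, …, x_n]`, for an invertible matrix `g` over `K` with rows and columns `0, …, k`. -/
noncomputable def coordChange {n : ℕ} {K : Type*} [Field K] (A : Type*) [CommRing A] [Algebra K A]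
    {k : Fin (n + 1)} (g : Matrix.GeneralLinearGroup {i : Fin (n + 1) // i ≤ k} K) :
    Poly n A →ₐ[A] Poly n A :=
  aeval fun i => if h : i ≤ k then
    ∑ l : {i : Fin (n + 1) // i ≤ k}, C (algebraMap K A (g.val ⟨i, h⟩ l)) * X l.val
  else X i

theorem extend_le_comap_coordChange {n : ℕ} {K : Type*} [Field K] (A : Type*) [CommRing A]
    [Algebra K A] {I : Ideal (Poly n K)} (hI : IsQuasiStable I) {k : Fin (n + 1)}
    (hk : IsLastFreeVar I k) (g : Matrix.GeneralLinearGroup {i : Fin (n + 1) // i ≤ k} K) :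
    extend A I ≤ (extend A I).comap (coordChange A g).toRingHom := by
  obtain ⟨U, hU⟩ := hI
  have hmem : ∀ α : Term n, term K α ∈ I → term A α ∈ extend A I := fun α h => by
    simpa [extend] using Ideal.mem_map_of_mem (MvPolynomial.map (algebraMap K A)) h
  have hspan : extend A I = Ideal.span (term A '' (U : Set (Term n))) := by
    rw [extend, ← hU.span_eq, Ideal.map_span, Set.image_image]
    simp
  conv_lhs => rw [hspan]
  rw [Ideal.span_le]
  rintro _ ⟨α, hα, rfl⟩
  have hαI : term K α ∈ I := hU.span_eq ▸ Ideal.subset_span ⟨α, hα, rfl⟩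
  obtain ⟨β, hβα, hβ⟩ := exists_minimal_le_of_wellFoundedLT
    (fun β : Term n => term K β ∈ I) α hαI
  have hfix : coordChange A g (term A β) = term A β := by
    rw [coordChange, aeval_monomial, map_one, one_mul, term, monomial_eq, C_1, one_mul]
    refine Finsupp.prod_congr fun i hi => ?_
    have hki : k < i := (hk i).2 ⟨β, hβ, Finsupp.mem_support_iff.1 hi⟩
    rw [dif_neg (not_le.2 hki)]
  have hsplit : term A α = term A (α - β) * term A β := by
    simp [term, monomial_mul, tsub_add_cancel_of_le hβα]
  change coordChange A g (term A α) ∈ extend A I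
  rw [hsplit, map_mul, hfix]
  exact Ideal.mul_mem_left _ _ (hmem β hβ.1)

/-- The endomorphism `g̃` of `A[x_0, …, x_n] / I` induced by the coordinate change `g`. It is
invertible, with inverse induced by the inverse matrix. -/
noncomputable def inducedMap {n : ℕ} {K : Type*} [Field K] (A : Type*) [CommRing A]
    [Algebra K A] {I : Ideal (Poly n K)} (hI : IsQuasiStable I) {k : Fin (n + 1)}
    (hk : IsLastFreeVar I k) (g : Matrix.GeneralLinearGroup {i : Fin (n + 1) // i ≤ k} K) :
    (Poly n A ⧸ extend A I) →+* (Poly n A ⧸ extend A I) :=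
  Ideal.quotientMap (extend A I) (coordChange A g).toRingHom
    (extend_le_comap_coordChange A hI hk g)

end RelMarked

/-! The ideal `J'` is a generic initial ideal of `J` for the degree reverse lexicographic order with
`x_0` smallest, where only `x_0, …, x_k` are made generic. Such coordinate changes fix the minimal
generators of `I`, so they act on the quotient by `I`.

The Cohen-Macaulay hypothesis enters through `IsLastFreeVar.exists_single_mem_termSet`: `I`, hence
`J`, contains a power of every `x_i` with `i > k`. A prime over `J` that contains `x_0, …, x_k` is
therefore the irrelevant ideal, so forms in these variables with coefficients in the infinite field
`K` can avoid all relevant associated primes (`exists_linForm_regular`). This yields `k + 1`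
independent linear forms, each regular in large degrees modulo `J` and its predecessors; the first
is regular in all degrees because `J` is saturated. Taking them as coordinates turns `J` into an
ideal `B` (`exists_isRegularFrom_coordEquiv`).

For this order, such regularity passes to initial terms (`isEventuallyStable_initTerms`): in large
degrees, the initial terms of `B` are stable under division by their smallest variable, which gives
a finite Pommaret basis (`exists_pommaretBasis`). Stability under division by `x_0` in all degrees
gives saturation of `J'`.

Finally, reduced elements of `B` whose leading terms form the Pommaret basis of the truncated `J'`
give the relative marked basis of the truncation of `B` (`exists_isRelMarkedBasis`). Since `t` is at
least the regularity of `J`, the truncation of `J` is generated by `J_t`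
(`truncGE_eq_span_degPart`), and modulo `I` only `H` survives. -/

namespace RelMarked

variable {n : ℕ}

/-! ### Pommaret bases of sets of terms -/

/-- From degree `d` on, membership of `α + e_j` in `M` implies membership of `α`, if `α` involves no
variable smaller than `x_j`. -/
def IsEventuallyStable (M : Set (Term n)) (d : ℕ) : Prop :=
  ∀ (α : Term n) (j : Fin (n + 1)), (∀ i < j, α i = 0) → d ≤ α.degree →
    α + Finsupp.single j 1 ∈ M → α ∈ M

theorem self_mem_pommaretCone (α : Term n) : α ∈ pommaretCone α := ⟨0, by simp, by simp⟩

theorem exists_eq_add_single {α : Term n} (hα : α ≠ 0) :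
    ∃ (j : Fin (n + 1)) (β : Term n), α = β + Finsupp.single j 1 ∧ ∀ i < j, β i = 0 := by
  classical
  have hne : α.support.Nonempty := Finsupp.support_nonempty_iff.2 hα
  refine ⟨α.support.min' hne, α - Finsupp.single (α.support.min' hne) 1, ?_, fun i hi => ?_⟩
  · refine (tsub_add_cancel_of_le ?_).symm
    rw [Finsupp.single_le_iff, Nat.one_le_iff_ne_zero]
    exact Finsupp.mem_support_iff.1 (Finset.min'_mem _ hne)
  · have : α i = 0 := by
      by_contra h
      exact absurd (Finset.min'_le _ _ (Finsupp.mem_support_iff.2 h)) (not_le.2 hi)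
    simp [this]

/-- The multiplier `δ` must contain `x_j`: otherwise `β` contains `x_j` and `δ` involves only larger
variables, against the cone condition. Hence one factor `x_j` can be removed from `δ`. -/
theorem mem_pommaretCone_of_add_single {α β : Term n} {j : Fin (n + 1)}
    (h : α + Finsupp.single j 1 ∈ pommaretCone β) (hne : α + Finsupp.single j 1 ≠ β)
    (hα : ∀ i < j, α i = 0) : α ∈ pommaretCone β := by
  obtain ⟨δ, hδ, hle⟩ := h
  have hcoeff : ∀ i, α i + Finsupp.single j 1 i = δ i + β i := fun i => by
    simpa using DFunLike.congr_fun hδ i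
  have hj : δ j ≠ 0 := by
    intro h0
    have hδ0 : δ ≠ 0 := fun h => hne (by simpa [h] using hδ)
    obtain ⟨i, hi⟩ := Finsupp.ne_iff.1 hδ0
    have hij : i ≠ j := fun h => hi (by simpa [h] using h0)
    have hji : j < i := by
      refine lt_of_le_of_ne (not_lt.1 fun hlt => hi ?_) hij.symm
      have := hcoeff i
      rw [hα i hlt, Finsupp.single_eq_of_ne hij] at this
      simp only [Finsupp.coe_zero, Pi.zero_apply]
      omega
    have hβ : β j ≠ 0 := by
      have := hcoeff j
      rw [h0, Finsupp.single_eq_same] at this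
      omega
    exact absurd (hle i hi j hβ) (not_le.2 hji)
  refine ⟨δ - Finsupp.single j 1, ?_, fun i hi => hle i fun h => hi (by simp [h])⟩
  have hs : δ - Finsupp.single j 1 + Finsupp.single j 1 = δ :=
    tsub_add_cancel_of_le (by rw [Finsupp.single_le_iff]; omega)
  apply add_right_cancel (b := Finsupp.single j 1)
  rw [hδ, add_right_comm, hs]

/-- The basis consists of the terms of `M` that leave `M` on division by their smallest variable.
Eventual stability bounds their degrees by `d`. -/
theorem exists_pommaretBasis {M : Set (Term n)} (hM : IsUpperSet M) {d : ℕ}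
    (hd : IsEventuallyStable M d) :
    ∃ U : Finset (Term n), (U : Set (Term n)).PairwiseDisjoint pommaretCone ∧
      M = ⋃ α ∈ U, pommaretCone α := by
  classical
  set U : Set (Term n) := {α | α ∈ M ∧ ∀ (j : Fin (n + 1)) (β : Term n),
    α = β + Finsupp.single j 1 → (∀ i < j, β i = 0) → β ∉ M} with hU
  have hfin : U.Finite := by
    refine (Finsupp.finite_of_degree_le (σ := Fin (n + 1)) d).subset fun α hα => ?_
    by_cases h0 : α = 0
    · simp [h0]
    · obtain ⟨j, β, rfl, hβ⟩ := exists_eq_add_single h0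
      by_contra hlt
      have hlt' : ¬ (β + Finsupp.single j 1).degree ≤ d := hlt
      rw [map_add, Finsupp.degree_single] at hlt'
      exact hα.2 j β rfl hβ (hd β j hβ (by omega) hα.1)
  have hcone : ∀ α ∈ M, pommaretCone α ⊆ M := by
    rintro α hα _ ⟨δ, rfl, -⟩
    exact hM le_add_self hα
  refine ⟨hfin.toFinset, ?_, ?_⟩
  · rw [hfin.coe_toFinset]
    -- If `u` were in the cone of another `v`, its quotient by its smallest variable would stay in
    -- that cone, hence in `M`.
    have key : ∀ u ∈ U, ∀ v ∈ U, u ∈ pommaretCone v → u = v := by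
      intro u hu v hv huv
      by_contra hne
      have h0 : u ≠ 0 := by
        rintro rfl
        obtain ⟨δ, hδ, -⟩ := huv
        exact hne (add_eq_zero.1 hδ.symm).2.symm
      obtain ⟨j, β, rfl, hβ⟩ := exists_eq_add_single h0
      exact hu.2 j β rfl hβ (hcone v hv.1 (mem_pommaretCone_of_add_single huv hne hβ))
    intro u hu v hv huv
    -- A common term of two cones that is neither vertex stays common after division by its smallest
    -- variable, so induction on the degree applies.
    refine Set.disjoint_left.2 fun γ => ?_
    induction hγ : γ.degree generalizing γ with
    | zero =>
      intro h1 h2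
      have h0 : γ = 0 := (Finsupp.degree_eq_zero_iff γ).1 hγ
      have : ∀ w, γ ∈ pommaretCone w → w = 0 := by
        rintro w ⟨δ, hδ, -⟩
        exact (add_eq_zero.1 (hδ.symm.trans h0)).2
      exact huv ((this u h1).trans (this v h2).symm)
    | succ e ih =>
      intro h1 h2
      by_cases hγu : γ = u
      · exact huv (key u hu v hv (hγu ▸ h2))
      by_cases hγv : γ = v
      · exact huv (key v hv u hu (hγv ▸ h1)).symm
      have h0 : γ ≠ 0 := by
        rintro rfl
        simp at hγ
      obtain ⟨j, β, rfl, hβ⟩ := exists_eq_add_single h0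
      refine ih β ?_ (mem_pommaretCone_of_add_single h1 hγu hβ)
        (mem_pommaretCone_of_add_single h2 hγv hβ)
      simpa using hγ
  · refine Set.Subset.antisymm (fun α => ?_) ?_
    · induction hα : α.degree using Nat.strong_induction_on generalizing α with
      | _ e ih =>
      intro hαM
      by_cases hαU : α ∈ U
      · exact Set.mem_biUnion (hfin.mem_toFinset.2 hαU) (self_mem_pommaretCone α)
      · have : ∃ (j : Fin (n + 1)) (β : Term n), α = β + Finsupp.single j 1 ∧
            (∀ i < j, β i = 0) ∧ β ∈ M := by
          by_contra! hcon
          exact hαU ⟨hαM, hcon⟩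
        obtain ⟨j, β, rfl, hβ, hβM⟩ := this
        rw [map_add, Finsupp.degree_single] at hα
        obtain ⟨u, hu, δ, hδ, hle⟩ := Set.mem_iUnion₂.1 (ih β.degree (by omega) β rfl hβM)
        -- The variable `x_j` is admissible for `u`, because `u` divides `β`, which has no variable
        -- below `x_j`.
        refine Set.mem_biUnion hu ⟨δ + Finsupp.single j 1, by rw [hδ, add_right_comm], ?_⟩
        intro i hi l hl
        by_cases hδi : δ i = 0
        · have hij : i = j := by
            by_contra h
            exact hi (by simp [hδi, Finsupp.single_eq_of_ne h])
          refine not_lt.1 fun hlt => hl ?_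
          have := hβ l (hij ▸ hlt)
          rw [hδ, Finsupp.add_apply] at this
          omega
        · exact hle i hδi l hl
    · exact Set.iUnion₂_subset fun α hα => hcone α (hfin.mem_toFinset.1 hα).1

theorem isEventuallyStable_of_eq_biUnion {M : Set (Term n)} {U : Finset (Term n)}
    (hU : M = ⋃ α ∈ U, pommaretCone α) :
    IsEventuallyStable M (U.sup Finsupp.degree) := by
  intro α j hα hd hmem
  rw [hU] at hmem ⊢
  obtain ⟨u, hu, hαu⟩ := Set.mem_iUnion₂.1 hmem
  refine Set.mem_biUnion hu (mem_pommaretCone_of_add_single hαu ?_ hα)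
  rintro rfl
  have := Finset.le_sup (f := Finsupp.degree) hu
  rw [map_add, Finsupp.degree_single] at this
  omega

theorem IsEventuallyStable.inter_degree_ge {M : Set (Term n)} {d : ℕ}
    (h : IsEventuallyStable M d) (t : ℕ) :
    IsEventuallyStable {α | α ∈ M ∧ t ≤ α.degree} (max d t) := fun α j hα hd hmem =>
  ⟨h α j hα (le_trans (le_max_left _ _) hd) hmem.1, le_trans (le_max_right _ _) hd⟩

/-! ### The degree reverse lexicographic order -/

/-- The terms, with the degree reverse lexicographic order for which `x_0 < ⋯ < x_n`. -/
def DegRevLex (n : ℕ) : Type := Term n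

namespace DegRevLex

/-- Comparing the degrees and then lexicographically the degrees of the parts in
`x_{i+1}, …, x_n` is comparing terms for the degree reverse lexicographic order. -/
noncomputable def key : Term n →+ ℕ ×ₗ Lex (Fin (n + 1) → ℕ) where
  toFun α := toLex (α.degree, toLex fun i => ∑ l ∈ Finset.Ioi i, α l)
  map_zero' := by
    simp
    rfl
  map_add' α β := by
    simp [Finset.sum_add_distrib]
    rfl

theorem degree_eq_sum (α : Term n) (i : Fin (n + 1)) :
    α.degree = ∑ l ∈ Finset.Iio i, α l + α i + ∑ l ∈ Finset.Ioi i, α l := by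
  classical
  rw [Finsupp.degree_eq_sum, add_assoc, add_comm (α i), ← Finset.sum_erase_add _ _ (Finset.mem_univ i)]
  have : (Finset.univ.erase i) = Finset.Iio i ∪ Finset.Ioi i := by
    ext l
    simp [lt_or_lt_iff_ne]
  rw [this, Finset.sum_union, add_assoc]
  exact Finset.disjoint_left.2 fun l h1 h2 =>
    lt_asymm (Finset.mem_Iio.1 h1) (Finset.mem_Ioi.1 h2)

/-- In equal degree, the tail sums in `key` are complementary to the head sums, so the smallest
variable with different exponents decides, and the larger exponent gives the smaller term. -/
theorem key_lt_key {α β : Term n} (hdeg : α.degree = β.degree) {i : Fin (n + 1)}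
    (heq : ∀ l < i, α l = β l) (hlt : β i < α i) :
    key α < key β := by
  have hsum : ∀ j ≤ i, ∑ l ∈ Finset.Iio j, α l = ∑ l ∈ Finset.Iio j, β l := fun j hj =>
    Finset.sum_congr rfl fun l hl => heq l ((Finset.mem_Iio.1 hl).trans_le hj)
  refine Prod.Lex.toLex_lt_toLex.2 (Or.inr ⟨hdeg, i, fun j hj => ?_, ?_⟩)
  · have h1 := degree_eq_sum α j
    have h2 := degree_eq_sum β j
    have h3 := hsum j hj.le
    have h4 := heq j hj
    change ∑ l ∈ Finset.Ioi j, α l = ∑ l ∈ Finset.Ioi j, β l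
    omega
  · have h1 := degree_eq_sum α i
    have h2 := degree_eq_sum β i
    have h3 := hsum i le_rfl
    change ∑ l ∈ Finset.Ioi i, α l < ∑ l ∈ Finset.Ioi i, β l
    omega

theorem key_injective : Function.Injective (key (n := n)) := by
  intro α β h
  by_contra hne
  have hdeg : α.degree = β.degree := congrArg (fun x => (ofLex x).1) h
  obtain ⟨l, hl⟩ := Finsupp.ne_iff.1 hne
  classical
  obtain ⟨i, hi, hmin⟩ := WellFounded.has_min (wellFounded_lt (α := Fin (n + 1)))
    {l | α l ≠ β l} ⟨l, hl⟩
  have heq : ∀ l < i, α l = β l := fun l hlt => by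
    by_contra hc
    exact hmin l hc hlt
  rcases lt_or_gt_of_ne hi with h1 | h1
  · exact absurd h (key_lt_key hdeg.symm (fun l hl => (heq l hl).symm) h1).ne'
  · exact absurd h (key_lt_key hdeg heq h1).ne

noncomputable instance : AddCommMonoid (DegRevLex n) := inferInstanceAs (AddCommMonoid (Term n))

noncomputable instance : LinearOrder (DegRevLex n) :=
  LinearOrder.lift' (α := DegRevLex n) (fun α => key (n := n) α) key_injective

instance : IsOrderedAddMonoid (DegRevLex n) :=
  Function.Injective.isOrderedAddMonoid (β := DegRevLex n) (fun α => key (n := n) α)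
    (map_add (key (n := n))) Iff.rfl

instance : WellFoundedLT (DegRevLex n) :=
  ⟨InvImage.wf (fun α : DegRevLex n => key (n := n) α)
    (wellFounded_lt (α := ℕ ×ₗ Lex (Fin (n + 1) → ℕ)))⟩

end DegRevLex

/-- The degree reverse lexicographic order for which `x_0 < ⋯ < x_n`. -/
noncomputable def degRevLex (n : ℕ) : MonomialOrder (Fin (n + 1)) where
  syn := DegRevLex n
  toSyn :=
    { toFun := fun α : Term n => (α : DegRevLex n)
      invFun := fun α => α
      left_inv := fun _ => rfl
      right_inv := fun _ => rfl
      map_add' := fun _ _ => rfl }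
  toSyn_monotone := by
    intro α β h
    obtain ⟨γ, rfl⟩ := exists_add_of_le h
    change DegRevLex.key α ≤ DegRevLex.key (α + γ)
    rw [map_add]
    refine le_add_of_nonneg_right ?_
    exact Prod.Lex.toLex_mono (a := (0, toLex 0)) (b := (_, toLex _))
      ⟨Nat.zero_le _, Pi.toLex_monotone fun i => Nat.zero_le _⟩

theorem degRevLex_lt {α β : Term n} (hdeg : α.degree = β.degree) {i : Fin (n + 1)}
    (heq : ∀ l < i, α l = β l) (hlt : β i < α i) :
    (degRevLex n).toSyn α < (degRevLex n).toSyn β :=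
  DegRevLex.key_lt_key (α := α) (β := β) hdeg heq hlt

/-- The property that makes reverse lexicographic orders suitable here: working modulo `x_0, …,
x_{j-1}` only discards terms smaller than those free of these variables. -/
theorem degRevLex_lt_of_ne_zero {α β : Term n} (hdeg : α.degree = β.degree) {i j : Fin (n + 1)}
    (hβ : ∀ l < j, β l = 0) (hij : i < j) (hi : α i ≠ 0) :
    (degRevLex n).toSyn α < (degRevLex n).toSyn β := by
  obtain ⟨l, hl, hmin⟩ := WellFounded.has_min (wellFounded_lt (α := Fin (n + 1)))
    {l | α l ≠ 0} ⟨i, hi⟩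
  have hlj : l < j := lt_of_le_of_lt (not_lt.1 fun h => hmin i hi h) hij
  refine degRevLex_lt hdeg (i := l) (fun a ha => ?_) ?_
  · rw [hβ a (ha.trans hlj)]
    by_contra hc
    exact hmin a hc ha
  · rw [hβ l hlj]
    exact Nat.pos_of_ne_zero hl

/-! ### Truncations and monomial ideals -/

theorem isHomogeneous_iff_degree {A : Type*} [CommRing A] {f : Poly n A} {e : ℕ} :
    f.IsHomogeneous e ↔ ∀ α ∈ f.support, α.degree = e := by
  simp [IsHomogeneous, IsWeightedHomogeneous, Finsupp.degree_eq_weight_one, Pi.one_def]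

theorem homogeneousComponent_mem_restrictSupport {A : Type*} [CommRing A] {M : Set (Term n)}
    {f : Poly n A} (hf : f ∈ restrictSupport A M) (s : ℕ) :
    homogeneousComponent s f ∈ restrictSupport A M := by
  rw [mem_restrictSupport_iff] at hf ⊢
  intro α hα
  rw [Finset.mem_coe, support_homogeneousComponent, Finset.mem_filter] at hα
  exact hf hα.1

theorem mem_truncGE_iff {A : Type*} [CommRing A] {B : Ideal (Poly n A)}
    (hB : IsHomogeneousIdeal B) {t : ℕ} {f : Poly n A} :
    f ∈ truncGE B t ↔ f ∈ B ∧ ∀ α ∈ f.support, t ≤ α.degree := by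
  constructor
  · intro hf
    have hle : truncGE B t ≤ B ⊓ idealOfVars (Fin (n + 1)) A ^ t := by
      refine Ideal.span_le.2 (Set.iUnion₂_subset fun s hs g hg => ⟨hg.1, ?_⟩)
      refine (mem_pow_idealOfVars_iff t g).2 fun α hα => ?_
      have : α.degree = s := by
        by_contra h
        exact (mem_support_iff.1 hα) (hg.2.coeff_eq_zero h)
      omega
    exact ⟨(hle hf).1, (mem_pow_idealOfVars_iff t f).1 (hle hf).2⟩
  · rintro ⟨hf, ht⟩
    rw [← sum_homogeneousComponent f]
    refine Ideal.sum_mem _ fun s _ => ?_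
    by_cases hs : t ≤ s
    · exact Ideal.subset_span (Set.mem_biUnion hs ⟨homogeneousComponent_mem_of_mem hB hf s,
        homogeneousComponent_isHomogeneous s f⟩)
    · rw [homogeneousComponent_eq_zero' s f fun α hα h => hs (h ▸ ht α hα)]
      exact Ideal.zero_mem _

theorem isHomogeneousIdeal_iff {A : Type*} [CommRing A] {B : Ideal (Poly n A)} :
    IsHomogeneousIdeal B ↔ ∀ f ∈ B, ∀ s, homogeneousComponent s f ∈ B := by
  refine ⟨fun h f hf s => homogeneousComponent_mem_of_mem h hf s, fun h s f hf => ?_⟩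
  have := decomposition.decompose'_apply f s
  exact (congrArg (· ∈ B) this).mpr (h f hf s)

theorem IsHomogeneousIdeal.truncGE {A : Type*} [CommRing A] {B : Ideal (Poly n A)}
    (hB : IsHomogeneousIdeal B) (t : ℕ) : IsHomogeneousIdeal (truncGE B t) := by
  rw [isHomogeneousIdeal_iff]
  intro f hf s
  rw [mem_truncGE_iff hB] at hf ⊢
  refine ⟨homogeneousComponent_mem_of_mem hB hf.1 s, fun α hα => hf.2 α ?_⟩
  rw [support_homogeneousComponent, Finset.mem_filter] at hα
  exact hα.1

/-- The set of terms in the ideal `I`. -/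
def termSet {K : Type*} [Field K] (I : Ideal (Poly n K)) : Set (Term n) := {α | term K α ∈ I}

/-- `I` contains the terms of all its elements. -/
def IsMonomialIdeal {K : Type*} [Field K] (I : Ideal (Poly n K)) : Prop :=
  ∀ f ∈ I, ∀ α ∈ f.support, α ∈ termSet I

section Monomial

variable {K : Type*} [Field K] {I : Ideal (Poly n K)}

theorem isUpperSet_termSet (I : Ideal (Poly n K)) : IsUpperSet (termSet I) := by
  intro α β hle hα
  have : term K β = term K (β - α) * term K α := by
    simp [term, monomial_mul, tsub_add_cancel_of_le hle]
  rw [termSet, Set.mem_ofPred_eq, this]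
  exact Ideal.mul_mem_left _ _ hα

theorem isMonomialIdeal_span (s : Set (Term n)) :
    IsMonomialIdeal (Ideal.span (term K '' s)) := by
  intro f hf α hα
  obtain ⟨β, hβ, hle⟩ := mem_ideal_span_monomial_image.1 hf α hα
  exact isUpperSet_termSet _ hle (Ideal.subset_span ⟨β, hβ, rfl⟩)

theorem IsQuasiStable.isMonomialIdeal (hI : IsQuasiStable I) : IsMonomialIdeal I := by
  obtain ⟨U, hU⟩ := hI
  rw [← hU.span_eq]
  exact isMonomialIdeal_span _

theorem IsMonomialIdeal.eq_span (hI : IsMonomialIdeal I) :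
    I = Ideal.span (term K '' termSet I) := by
  refine le_antisymm (fun f hf => ?_) (Ideal.span_le.2 ?_)
  · exact mem_ideal_span_monomial_image.2 fun α hα => ⟨α, hI f hf α hα, le_rfl⟩
  · rintro _ ⟨α, hα, rfl⟩
    exact hα

theorem IsMonomialIdeal.mem_iff (hI : IsMonomialIdeal I) {f : Poly n K} :
    f ∈ I ↔ ∀ α ∈ f.support, α ∈ termSet I := by
  refine ⟨hI f, fun h => ?_⟩
  rw [hI.eq_span]
  exact mem_ideal_span_monomial_image.2 fun α hα => ⟨α, h α hα, le_rfl⟩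

theorem extend_span (A : Type*) [CommRing A] [Algebra K A] (s : Set (Term n)) :
    extend A (Ideal.span (term K '' s)) = Ideal.span (term A '' s) := by
  rw [extend, Ideal.map_span, Set.image_image]
  simp

theorem IsMonomialIdeal.mem_extend_iff (hI : IsMonomialIdeal I) {A : Type*} [CommRing A]
    [Algebra K A] {f : Poly n A} : f ∈ extend A I ↔ ∀ α ∈ f.support, α ∈ termSet I := by
  conv_lhs => rw [hI.eq_span, extend_span]
  rw [mem_ideal_span_monomial_image]
  exact ⟨fun h α hα => let ⟨β, hβ, hle⟩ := h α hα; isUpperSet_termSet I hle hβ,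
    fun h α hα => ⟨α, h α hα, le_rfl⟩⟩

theorem IsMonomialIdeal.isHomogeneousIdeal (hI : IsMonomialIdeal I) : IsHomogeneousIdeal I := by
  rw [isHomogeneousIdeal_iff]
  intro f hf s
  rw [hI.mem_iff] at hf ⊢
  intro α hα
  rw [support_homogeneousComponent, Finset.mem_filter] at hα
  exact hf α hα.1

theorem IsMonomialIdeal.mem_truncGE_iff (hI : IsMonomialIdeal I) {t : ℕ} {f : Poly n K} :
    f ∈ RelMarked.truncGE I t ↔ ∀ α ∈ f.support, α ∈ termSet I ∧ t ≤ α.degree := by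
  rw [RelMarked.mem_truncGE_iff hI.isHomogeneousIdeal, hI.mem_iff]
  exact ⟨fun h α hα => ⟨h.1 α hα, h.2 α hα⟩, fun h => ⟨fun α hα => (h α hα).1,
    fun α hα => (h α hα).2⟩⟩

theorem IsMonomialIdeal.termSet_truncGE (hI : IsMonomialIdeal I) (t : ℕ) :
    termSet (RelMarked.truncGE I t) = {α | α ∈ termSet I ∧ t ≤ α.degree} := by
  classical
  ext α
  rw [termSet, Set.mem_ofPred_eq, hI.mem_truncGE_iff]
  simp [term, support_monomial]

theorem IsMonomialIdeal.truncGE (hI : IsMonomialIdeal I) (t : ℕ) :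
    IsMonomialIdeal (RelMarked.truncGE I t) := by
  intro f hf α hα
  rw [hI.termSet_truncGE]
  exact hI.mem_truncGE_iff.1 hf α hα

theorem IsMonomialIdeal.exists_pommaretBasis (hI : IsMonomialIdeal I) {d : ℕ}
    (hd : IsEventuallyStable (termSet I) d) : ∃ U : Finset (Term n), IsPommaretBasis U I := by
  obtain ⟨U, hdisj, hU⟩ := RelMarked.exists_pommaretBasis (isUpperSet_termSet I) hd
  refine ⟨U, ?_, hdisj, hU⟩
  refine le_antisymm (Ideal.span_le.2 ?_) fun f hf => ?_
  · rintro _ ⟨α, hα, rfl⟩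
    change α ∈ termSet I
    rw [hU]
    exact Set.mem_biUnion hα (self_mem_pommaretCone α)
  · refine mem_ideal_span_monomial_image.2 fun α hα => ?_
    have := hI f hf α hα
    rw [hU] at this
    obtain ⟨u, hu, δ, rfl, -⟩ := Set.mem_iUnion₂.1 this
    exact ⟨u, hu, le_add_self⟩

theorem IsQuasiStable.exists_isEventuallyStable (hI : IsQuasiStable I) :
    ∃ d, IsEventuallyStable (termSet I) d := by
  obtain ⟨U, hU⟩ := hI
  exact ⟨_, isEventuallyStable_of_eq_biUnion hU.terms_eq⟩

theorem IsMonomialIdeal.exists_pommaretBasis_truncGE (hI : IsMonomialIdeal I) {d : ℕ}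
    (hd : IsEventuallyStable (termSet I) d) (t : ℕ) :
    ∃ U : Finset (Term n), IsPommaretBasis U (RelMarked.truncGE I t) := by
  refine (hI.truncGE t).exists_pommaretBasis (d := max d t) ?_
  rw [hI.termSet_truncGE]
  exact hd.inter_degree_ge t

theorem mem_restrictSupportIdeal {M : Set (Term n)} (hM : IsUpperSet M) {f : Poly n K} :
    f ∈ restrictSupportIdeal (R := K) M hM ↔ ∀ α ∈ f.support, α ∈ M := Iff.rfl

theorem termSet_restrictSupportIdeal {M : Set (Term n)} (hM : IsUpperSet M) :
    termSet (restrictSupportIdeal (R := K) M hM) = M := by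
  classical
  ext α
  rw [termSet, Set.mem_ofPred_eq, mem_restrictSupportIdeal]
  simp [term, support_monomial]

theorem isMonomialIdeal_restrictSupportIdeal {M : Set (Term n)} (hM : IsUpperSet M) :
    IsMonomialIdeal (restrictSupportIdeal (R := K) M hM) := by
  intro f hf
  rwa [termSet_restrictSupportIdeal]

end Monomial

/-! ### Initial terms for the degree reverse lexicographic order -/

section Initial

variable {L : Type*} [Field L] {B : Ideal (Poly n L)}

/-- The set of leading terms of the nonzero elements of the ideal `B`. -/
def initTerms (B : Ideal (Poly n L)) : Set (Term n) :=
  {α | ∃ f ∈ B, f ≠ 0 ∧ (degRevLex n).degree f = α}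

theorem isUpperSet_initTerms (B : Ideal (Poly n L)) : IsUpperSet (initTerms B) := by
  classical
  rintro α β hle ⟨f, hf, hf0, rfl⟩
  have h1 : term L (β - (degRevLex n).degree f) ≠ 0 := by simp [term]
  refine ⟨_, Ideal.mul_mem_left _ (term L (β - (degRevLex n).degree f)) hf,
    mul_ne_zero h1 hf0, ?_⟩
  rw [MonomialOrder.degree_mul h1 hf0, MonomialOrder.degree_monomial, if_neg one_ne_zero,
    tsub_add_cancel_of_le hle]

theorem mem_initTerms_of_term_mem {α : Term n} (h : term L α ∈ B) : α ∈ initTerms B := by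
  classical
  exact ⟨_, h, by simp [term], by rw [MonomialOrder.degree_monomial, if_neg one_ne_zero]⟩

/-- Division by all nonzero elements of `B` at once; over a field their leading coefficients are
units. -/
theorem exists_eq_add_of_initTerms (B : Ideal (Poly n L)) (f : Poly n L) :
    ∃ a ∈ B, ∃ r ∈ restrictSupport L (initTerms B)ᶜ, f = a + r := by
  obtain ⟨c, r, hf, -, hr⟩ := MonomialOrder.div_set (m := degRevLex n) (B := {b | b ∈ B ∧ b ≠ 0})
    (fun b hb => ((degRevLex n).leadingCoeff_ne_zero_iff.2 hb.2).isUnit) f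
  refine ⟨_, ?_, r, ?_, hf⟩
  · rw [Finsupp.linearCombination_apply]
    exact Ideal.sum_mem _ fun b _ => Ideal.mul_mem_left _ _ b.2.1
  · rw [mem_restrictSupport_iff]
    rintro α hα ⟨b, hb, hb0, rfl⟩
    exact hr _ hα b ⟨hb, hb0⟩ le_rfl

/-- This is the element of a reduced Gröbner basis type: `x^α` minus its normal form, cut down to
its component of degree `α.degree`. -/
theorem exists_isHomogeneous_of_mem_initTerms (hB : IsHomogeneousIdeal B) {α : Term n}
    (hα : α ∈ initTerms B) : ∃ f ∈ B, f.IsHomogeneous α.degree ∧ coeff α f = 1 ∧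
      f - term L α ∈ restrictSupport L (initTerms B)ᶜ := by
  classical
  obtain ⟨a, ha, r, hr, hf⟩ := exists_eq_add_of_initTerms B (term L α)
  have hc : homogeneousComponent α.degree (term L α) = term L α :=
    homogeneousComponent_eq_self (isHomogeneous_monomial _ rfl)
  have hr' := homogeneousComponent_mem_restrictSupport hr α.degree
  have hsum : term L α = homogeneousComponent α.degree a + homogeneousComponent α.degree r := by
    rw [← map_add, ← hf, hc]
  refine ⟨_, homogeneousComponent_mem_of_mem hB ha α.degree,
    homogeneousComponent_isHomogeneous _ _, ?_, ?_⟩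
  · have h0 : coeff α (homogeneousComponent α.degree r) = 0 := by
      by_contra h
      exact (mem_restrictSupport_iff L |>.1 hr') (mem_support_iff.2 h) hα
    have := congrArg (coeff α) hsum
    rw [coeff_add, h0, add_zero] at this
    rw [← this]
    simp [term]
  · have : homogeneousComponent α.degree a - term L α = -homogeneousComponent α.degree r := by
      rw [hsum]
      abel
    rw [this]
    exact Submodule.neg_mem _ hr'

theorem degRevLex_degree_eq {f : Poly n L} (hf : f ∈ B) {α : Term n} (hα : coeff α f = 1)
    (hf' : f - term L α ∈ restrictSupport L (initTerms B)ᶜ) : (degRevLex n).degree f = α := by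
  classical
  by_contra hne
  have hf0 : f ≠ 0 := by
    rintro rfl
    simp at hα
  refine (mem_restrictSupport_iff L |>.1 hf') (mem_support_iff.2 ?_) ⟨f, hf, hf0, rfl⟩
  rw [coeff_sub, term, coeff_monomial, if_neg (Ne.symm hne), sub_zero]
  exact (degRevLex n).coeff_degree_ne_zero_iff.2 hf0

/-- Eventual regularity of `x_j` modulo `B` and `x_0, …, x_{j-1}` makes the initial terms of `B`
stable under division by `x_j`. -/
theorem isEventuallyStable_initTerms (hB : IsHomogeneousIdeal B) {d : ℕ} {j : Fin (n + 1)}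
    (hj : ∀ f : Poly n L, (∃ e, d ≤ e ∧ f.IsHomogeneous e) →
      X j * f ∈ B ⊔ Ideal.span (X '' Set.Iio j) → f ∈ B ⊔ Ideal.span (X '' Set.Iio j))
    {α : Term n} (hα : ∀ i < j, α i = 0) (hd : d ≤ α.degree)
    (hmem : α + Finsupp.single j 1 ∈ initTerms B) : α ∈ initTerms B := by
  classical
  obtain ⟨h, hh, hhom, hcoeff, hsupp⟩ := exists_isHomogeneous_of_mem_initTerms hB hmem
  have hdeg := degRevLex_degree_eq hh hcoeff hsupp
  have hγ : (α + Finsupp.single j 1).degree = α.degree + 1 := by simp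
  rw [hγ] at hhom
  set f := h.divMonomial (Finsupp.single j 1) with hf
  have hfcoeff : ∀ β, coeff β f = coeff (β + Finsupp.single j 1) h := fun β => by
    rw [hf, coeff_divMonomial, add_comm β]
  have hfdeg : ∀ β ∈ f.support, β.degree = α.degree := by
    intro β hβ
    rw [mem_support_iff, hfcoeff] at hβ
    by_contra hne
    refine hβ (hhom.coeff_eq_zero ?_)
    simp
    omega
  have hfhom : f.IsHomogeneous α.degree := isHomogeneous_iff_degree.2 hfdeg
  -- A term of `h` divisible by no `x_i` with `i ≤ j` would exceed the leading term `α + e_j`, which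
  -- contains `x_j`.
  have hmod : h.modMonomial (Finsupp.single j 1) ∈ Ideal.span (X '' Set.Iio j) := by
    refine mem_ideal_span_X_image.2 fun β hβ => ?_
    rw [mem_support_iff] at hβ
    have hle : ¬ Finsupp.single j 1 ≤ β := fun hle => hβ (coeff_modMonomial_of_le _ hle)
    rw [coeff_modMonomial_of_not_le _ hle] at hβ
    by_contra! hcon
    have hβj : β j = 0 := by
      by_contra h0
      exact hle (by rw [Finsupp.single_le_iff]; omega)
    have hlt := degRevLex_lt (α := α + Finsupp.single j 1) (β := β) (i := j) ?_ ?_ ?_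
    · refine absurd ((degRevLex n).le_degree (mem_support_iff.2 hβ)) (not_le.2 ?_)
      rwa [hdeg]
    · by_contra hne
      exact hβ (hhom.coeff_eq_zero fun h => hne (by rw [h, hγ]))
    · intro l hl
      simp [hα l hl, hcon l hl, Finsupp.single_eq_of_ne hl.ne]
    · simp [hβj]
  have hXf : X j * f ∈ B ⊔ Ideal.span (X '' Set.Iio j) := by
    have : X j * f = h - h.modMonomial (Finsupp.single j 1) := by
      rw [eq_sub_iff_add_eq]
      exact divMonomial_add_modMonomial_single h j
    rw [this]
    exact Ideal.sub_mem _ (Ideal.mem_sup_left hh) (Ideal.mem_sup_right hmod)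
  -- The component of `b` has leading term `α`: the terms of `f` are terms of `h` divided by `x_j`,
  -- so at most `α`, and those of `c` contain a variable below `x_j`, so in degree `α.degree` they
  -- are smaller than `α`.
  obtain ⟨b, hb, c, hc, hbc⟩ := Submodule.mem_sup.1 (hj f ⟨_, hd, hfhom⟩ hXf)
  have hc' : ∀ β ∈ (homogeneousComponent α.degree c).support, ∃ i < j, β i ≠ 0 := by
    intro β hβ
    rw [support_homogeneousComponent, Finset.mem_filter] at hβ
    exact mem_ideal_span_X_image.1 hc β hβ.1
  have hsum : homogeneousComponent α.degree b = f - homogeneousComponent α.degree c := by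
    rw [eq_sub_iff_add_eq, ← map_add, hbc, homogeneousComponent_eq_self hfhom]
  have hcα : coeff α (homogeneousComponent α.degree c) = 0 := by
    by_contra h0
    obtain ⟨i, hi, hne⟩ := hc' α (mem_support_iff.2 h0)
    exact hne (hα i hi)
  have hbα : coeff α (homogeneousComponent α.degree b) ≠ 0 := by
    rw [hsum, coeff_sub, hcα, hfcoeff, hcoeff]
    simp
  refine ⟨homogeneousComponent α.degree b, homogeneousComponent_mem_of_mem hB hb _, ?_, ?_⟩
  · intro h0
    rw [h0] at hbα
    simp at hbα
  · apply (degRevLex n).toSyn.injective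
    refine le_antisymm ((degRevLex n).degree_le_iff.2 fun β hβ => ?_)
      ((degRevLex n).le_degree (mem_support_iff.2 hbα))
    rw [hsum] at hβ
    rcases Finset.mem_union.1 (support_sub _ _ _ hβ) with hβ | hβ
    · rw [mem_support_iff, hfcoeff] at hβ
      have := (degRevLex n).le_degree (mem_support_iff.2 hβ)
      rw [hdeg, map_add, map_add] at this
      exact le_of_add_le_add_right this
    · obtain ⟨i, hi, hne⟩ := hc' β hβ
      rw [support_homogeneousComponent, Finset.mem_filter] at hβ
      exact (degRevLex_lt_of_ne_zero hβ.2 hα hi hne).le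

end Initial

/-! ### Cohen-Macaulay quasi-stable ideals -/

theorem isPrime_span_X (K : Type*) [Field K] (s : Set (Fin (n + 1))) :
    (Ideal.span (X '' s : Set (Poly n K))).IsPrime := by
  classical
  set q : Poly n K →ₐ[K] Poly n K := aeval fun i => if i ∈ s then 0 else X i with hq
  have hker : Ideal.span (X '' s : Set (Poly n K)) = RingHom.ker q := by
    refine le_antisymm (Ideal.span_le.2 ?_) fun f hf => ?_
    · rintro _ ⟨i, hi, rfl⟩
      simp [hq, hi]
    · have hcomp : (Ideal.Quotient.mkₐ K (Ideal.span (X '' s : Set (Poly n K)))).comp q =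
          Ideal.Quotient.mkₐ K (Ideal.span (X '' s : Set (Poly n K))) := by
        refine algHom_ext fun i => ?_
        by_cases hi : i ∈ s
        · have : Ideal.Quotient.mk (Ideal.span (X '' s : Set (Poly n K))) (X i) = 0 :=
            Ideal.Quotient.eq_zero_iff_mem.2 (Ideal.subset_span ⟨i, hi, rfl⟩)
          simp [hq, hi, this]
        · simp [hq, hi]
      have := DFunLike.congr_fun hcomp f
      rw [AlgHom.comp_apply, (RingHom.mem_ker).1 hf, map_zero] at this
      exact Ideal.Quotient.eq_zero_iff_mem.1 this.symm
  rw [hker]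
  exact RingHom.ker_isPrime _

section

variable {K : Type*} [Field K] {I : Ideal (Poly n K)} {k : Fin (n + 1)}

/-- A minimal generator dividing `β + γ` involves only variables beyond `x_k`, where `β` vanishes;
so it divides `γ`. -/
theorem IsLastFreeVar.mem_termSet_of_add (hk : IsLastFreeVar I k) {β γ : Term n}
    (hβ : ∀ i, k < i → β i = 0) (h : β + γ ∈ termSet I) : γ ∈ termSet I := by
  obtain ⟨α, hle, hα⟩ := exists_minimal_le_of_wellFoundedLT
    (fun β : Term n => term K β ∈ I) _ h
  refine isUpperSet_termSet I (fun i => ?_) hα.1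
  by_cases hi : k < i
  · simpa [hβ i hi] using hle i
  · have : α i = 0 := by
      by_contra h0
      exact hi ((hk i).2 ⟨α, hα, h0⟩)
    simp [this]

theorem IsLastFreeVar.mem_termSet_of_mul_mem (hI : IsMonomialIdeal I) (hk : IsLastFreeVar I k)
    {f : Poly n K} (hf : f ∉ Ideal.span (X '' Set.Ioi k)) {γ : Term n}
    (h : f * term K γ ∈ I) : γ ∈ termSet I := by
  rw [mem_ideal_span_X_image] at hf
  push Not at hf
  obtain ⟨β, hβ, hzero⟩ := hf
  refine hk.mem_termSet_of_add (β := β) (fun i hi => hzero i hi) (hI _ h _ ?_)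
  rw [mem_support_iff, coeff_mul_monomial, mul_one]
  exact mem_support_iff.1 hβ

/-- With `j = k + 1`, consider the terms outside `I`, in variables from `x_j` on, that `x_j`
multiplies into `I`. Eventual stability makes them finite in number, a minimal generator divided by
`x_j` is one of them, and a maximal one is killed by every `x_l` with `l > k`. -/
theorem IsLastFreeVar.exists_socle_term (hI : IsQuasiStable I) (hk : IsLastFreeVar I k)
    {i : Fin (n + 1)} (hi : k < i) :
    ∃ γ ∉ termSet I, ∀ l, k < l → γ + Finsupp.single l 1 ∈ termSet I := by
  have hkn : k.val + 1 < n + 1 := lt_of_le_of_lt (Nat.succ_le_of_lt hi) i.2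
  set j : Fin (n + 1) := ⟨k.val + 1, hkn⟩ with hj
  have hlt : ∀ l, k < l ↔ j ≤ l := fun l => Iff.rfl
  obtain ⟨d, hd⟩ := hI.exists_isEventuallyStable
  obtain ⟨α, hα, hαj⟩ := (hk j).1 ((hlt j).2 le_rfl)
  have hα0 : ∀ l < j, α l = 0 := by
    intro l hl
    by_contra h0
    exact absurd ((hlt l).1 ((hk l).2 ⟨α, hα, h0⟩)) (not_le.2 hl)
  set S : Set (Term n) := {γ | γ ∉ termSet I ∧ γ + Finsupp.single j 1 ∈ termSet I ∧
    ∀ l < j, γ l = 0} with hS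
  have hfin : S.Finite := by
    refine (Finsupp.finite_of_degree_le (σ := Fin (n + 1)) d).subset fun γ hγ => ?_
    by_contra hlt'
    exact hγ.1 (hd γ j hγ.2.2 (le_of_lt (not_le.1 hlt')) hγ.2.1)
  have hsub : α - Finsupp.single j 1 + Finsupp.single j 1 = α :=
    tsub_add_cancel_of_le (by rw [Finsupp.single_le_iff]; omega)
  have hne : S.Nonempty := by
    refine ⟨α - Finsupp.single j 1, fun h => ?_, by rw [hsub]; exact hα.1, fun l hl => ?_⟩
    · have := hα.2 h tsub_le_self j
      simp only [Finsupp.coe_tsub, Pi.sub_apply, Finsupp.single_eq_same] at this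
      omega
    · simp [hα0 l hl]
  obtain ⟨γ, hγ⟩ := hfin.exists_maximal hne
  refine ⟨γ, hγ.1.1, fun l hl => ?_⟩
  by_contra hcon
  have hmem : γ + Finsupp.single l 1 ∈ S := by
    refine ⟨hcon, isUpperSet_termSet I ?_ hγ.1.2.1, fun m hm => ?_⟩
    · gcongr
      exact le_self_add
    · rw [Finsupp.add_apply, hγ.1.2.2 m hm,
        Finsupp.single_eq_of_ne (hm.trans_le ((hlt l).1 hl)).ne, add_zero]
  have := hγ.2 hmem le_self_add l
  simp at this

/-- If `x_{k+1}, …, x_n` are the variables occurring in the minimal generators of the quasi-stable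
ideal `I` and the quotient is Cohen-Macaulay, then `I` contains powers of all these variables. -/
theorem IsLastFreeVar.exists_single_mem_termSet (hI : IsQuasiStable I)
    (hCM : IsCohenMacaulayRing (Poly n K ⧸ I)) (hk : IsLastFreeVar I k) {i : Fin (n + 1)}
    (hi : k < i) : ∃ s, Finsupp.single i s ∈ termSet I := by
  have hmon := hI.isMonomialIdeal
  obtain ⟨γ, hγ, hsocle⟩ := hk.exists_socle_term hI hi
  set P : Ideal (Poly n K) := Ideal.span (X '' Set.Ioi k) with hP
  have hPprime : P.IsPrime := isPrime_span_X K _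
  -- Were some `f ∈ I` outside `P`, then `f * x^γ ∈ I` would force `γ` into `I`.
  have hIP : I ≤ P := by
    intro f hf
    by_contra hfP
    exact hγ (hk.mem_termSet_of_mul_mem hmon hfP (Ideal.mul_mem_right _ _ hf))
  set p : Ideal (Poly n K ⧸ I) := P.map (Ideal.Quotient.mk I) with hp
  have hker : RingHom.ker (Ideal.Quotient.mk I) ≤ P := by rwa [Ideal.mk_ker]
  have : p.IsPrime := Ideal.map_isPrime_of_surjective Ideal.Quotient.mk_surjective hker
  have hzero : ∀ δ : Term n, algebraMap _ (Localization.AtPrime p)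
      (Ideal.Quotient.mk I (term K δ)) = 0 → δ ∈ termSet I := by
    intro δ h
    obtain ⟨⟨u, hu⟩, hmul⟩ := (IsLocalization.map_eq_zero_iff p.primeCompl _ _).1 h
    obtain ⟨f, rfl⟩ := Ideal.Quotient.mk_surjective u
    rw [← map_mul, Ideal.Quotient.eq_zero_iff_mem] at hmul
    exact hk.mem_termSet_of_mul_mem hmon (fun hf => hu (Ideal.mem_map_of_mem _ hf)) hmul
  -- The socle term becomes a nonzero element killed by the maximal ideal at `P`. The local ring
  -- thus has depth zero, so dimension zero, and its maximal ideal is nil; `hzero` brings `x_i ^ s =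
  -- 0` back to `I`.
  set w := algebraMap _ (Localization.AtPrime p) (Ideal.Quotient.mk I (term K γ)) with hw
  have hmax : p.map (algebraMap _ (Localization.AtPrime p)) =
    IsLocalRing.maximalIdeal (Localization.AtPrime p) := Localization.AtPrime.map_eq_maximalIdeal
  have hann : ∀ r ∈ IsLocalRing.maximalIdeal (Localization.AtPrime p), r * w = 0 := by
    have hle : p.map (algebraMap _ (Localization.AtPrime p)) ≤
        LinearMap.ker (LinearMap.mulRight (Localization.AtPrime p) w) := by
      refine Ideal.map_le_iff_le_comap.2 (Ideal.map_le_iff_le_comap.2 (Ideal.span_le.2 ?_))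
      rintro _ ⟨l, hl, rfl⟩
      rw [SetLike.mem_coe, Ideal.mem_comap, Ideal.mem_comap, LinearMap.mem_ker,
        LinearMap.mulRight_apply, hw, ← map_mul, ← map_mul]
      have : X l * term K γ ∈ I := by
        have := hsocle l hl
        rw [termSet, Set.mem_ofPred_eq, term, ← mul_one (1 : K), ← monomial_mul, mul_comm] at this
        exact this
      rw [Ideal.Quotient.eq_zero_iff_mem.2 this, map_zero]
    intro r hr
    exact hle (hmax ▸ hr)
  obtain ⟨rs, hrs, hreg, hdim⟩ := hCM.2 p
  have hnil : rs = [] := by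
    cases rs with
    | nil => rfl
    | cons r rs =>
      exfalso
      have h1 := ((RingTheory.Sequence.isWeaklyRegular_cons_iff _ _ _).1 hreg.toIsWeaklyRegular).1
      refine hγ (hzero γ (h1 ?_))
      simpa using hann r (hrs r (by simp))
  rw [hnil] at hdim
  have : Ring.KrullDimLE 0 (Localization.AtPrime p) :=
    ringKrullDimZero_iff_ringKrullDim_eq_zero.2 (by simpa using hdim.symm)
  have hXi : algebraMap _ (Localization.AtPrime p) (Ideal.Quotient.mk I (X i)) ∈
      IsLocalRing.maximalIdeal (Localization.AtPrime p) := by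
    rw [← hmax]
    exact Ideal.mem_map_of_mem _ (Ideal.mem_map_of_mem _ (Ideal.subset_span ⟨i, hi, rfl⟩))
  obtain ⟨s, hs⟩ := Ring.KrullDimLE.isNilpotent_iff_mem_maximalIdeal.2 hXi
  refine ⟨s, hzero _ ?_⟩
  rw [← map_pow, ← map_pow, X_pow_eq_monomial] at hs
  exact hs

end

/-! ### Saturations and generic linear forms -/

section Saturation

variable {L : Type*} [Field L]

/-- The saturation of the ideal `B` with respect to `(x_0, …, x_n)`. -/
def saturation (B : Ideal (Poly n L)) : Ideal (Poly n L) where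
  carrier := {f | ∃ s, ∀ h ∈ idealOfVars (Fin (n + 1)) L ^ s, h * f ∈ B}
  zero_mem' := ⟨0, by simp⟩
  add_mem' := by
    rintro f g ⟨s, hs⟩ ⟨r, hr⟩
    refine ⟨max s r, fun h hh => ?_⟩
    rw [mul_add]
    exact B.add_mem (hs h (Ideal.pow_le_pow_right (le_max_left _ _) hh))
      (hr h (Ideal.pow_le_pow_right (le_max_right _ _) hh))
  smul_mem' := by
    rintro c f ⟨s, hs⟩
    refine ⟨s, fun h hh => ?_⟩
    rw [smul_eq_mul, mul_left_comm]
    exact B.mul_mem_left _ (hs h hh)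

theorem le_saturation (B : Ideal (Poly n L)) : B ≤ saturation B := fun _ hf =>
  ⟨0, fun _ _ => B.mul_mem_left _ hf⟩

theorem mem_saturation_of_X_mul_mem {B : Ideal (Poly n L)} {f : Poly n L}
    (h : ∀ i, X i * f ∈ saturation B) : f ∈ saturation B := by
  choose s hs using h
  refine ⟨Finset.univ.sup s + 1, fun h hh => ?_⟩
  rw [pow_succ] at hh
  have hle : idealOfVars (Fin (n + 1)) L ^ (Finset.univ.sup s) * idealOfVars (Fin (n + 1)) L ≤
      Submodule.comap (LinearMap.mulRight (Poly n L) f) B := by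
    refine Ideal.mul_le.2 fun r hr x hx => ?_
    have hle' : idealOfVars (Fin (n + 1)) L ≤
        Submodule.comap (LinearMap.mulRight (Poly n L) (r * f)) B := by
      refine Ideal.span_le.2 ?_
      rintro _ ⟨i, rfl⟩
      change X i * (r * f) ∈ B
      rw [mul_left_comm]
      exact hs i r (Ideal.pow_le_pow_right (Finset.le_sup (Finset.mem_univ i)) hr)
    have : x * (r * f) ∈ B := hle' hx
    change r * x * f ∈ B
    rwa [mul_comm r, mul_assoc]
  exact hle hh

theorem saturation_le_of_isSaturatedIdeal {B : Ideal (Poly n L)} (hB : IsSaturatedIdeal B) :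
    saturation B ≤ B := by
  rintro f ⟨s, hs⟩
  exact hB f s hs

theorem exists_pow_mul_saturation_le (B : Ideal (Poly n L)) :
    ∃ s, ∀ h ∈ idealOfVars (Fin (n + 1)) L ^ s, ∀ f ∈ saturation B, h * f ∈ B := by
  obtain ⟨G, hG⟩ := (isNoetherianRing_iff_ideal_fg _).1 inferInstance (saturation B)
  have hmem : ∀ b : G, (b : Poly n L) ∈ saturation B := fun b => hG ▸ Ideal.subset_span b.2
  choose s hs using hmem
  refine ⟨Finset.univ.sup s, fun h hh f hf => ?_⟩
  have hle : saturation B ≤ Submodule.comap (LinearMap.mulLeft (Poly n L) h) B := by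
    rw [← hG]
    refine Ideal.span_le.2 fun b hb => ?_
    exact hs ⟨b, hb⟩ h (Ideal.pow_le_pow_right (Finset.le_sup (Finset.mem_univ _)) hh)
  exact hle hf

/-- An ideal and its saturation agree in large degrees. Coefficients on generators of the saturation
are split at degree `s`: the high parts multiply the generators into `B`, and the low parts
contribute nothing in degree `e`. -/
theorem exists_mem_of_mem_saturation {B : Ideal (Poly n L)} (hB : IsHomogeneousIdeal B) :
    ∃ d, ∀ e ≥ d, ∀ f ∈ saturation B, f.IsHomogeneous e → f ∈ B := by
  classical
  obtain ⟨s, hs⟩ := exists_pow_mul_saturation_le B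
  obtain ⟨G, hG⟩ := (isNoetherianRing_iff_ideal_fg _).1 inferInstance (saturation B)
  refine ⟨s + G.sup totalDegree + 1, fun e he f hf hfe => ?_⟩
  have hf' := hf
  rw [← hG] at hf'
  obtain ⟨c, -, hc⟩ := Submodule.mem_span_finset.1 hf'
  rw [← homogeneousComponent_eq_self hfe, ← hc, map_sum]
  refine Ideal.sum_mem _ fun b hb => ?_
  set lo : Poly n L := ∑ i ∈ Finset.range s, homogeneousComponent i (c b) with hlo
  have hlodeg : lo.totalDegree ≤ s := by
    refine totalDegree_finsetSum_le fun i hi => ?_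
    exact (homogeneousComponent_isHomogeneous i (c b)).totalDegree_le.trans
      (Finset.mem_range.1 hi).le
  have hhi : c b - lo ∈ idealOfVars (Fin (n + 1)) L ^ s := by
    refine (mem_pow_idealOfVars_iff' _ _).2 fun α hα => ?_
    rw [coeff_sub, hlo, coeff_sum]
    simp only [coeff_homogeneousComponent]
    rw [Finset.sum_ite_eq, if_pos (Finset.mem_range.2 hα), sub_self]
  have hsplit : c b • b = lo * b + (c b - lo) * b := by
    rw [smul_eq_mul]
    ring
  have hdeg : (lo * b).totalDegree < e := by
    have h1 := totalDegree_mul lo b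
    have h2 := Finset.le_sup (f := totalDegree) hb
    omega
  rw [hsplit, map_add, homogeneousComponent_eq_zero _ _ hdeg, zero_add]
  exact homogeneousComponent_mem_of_mem hB (hs _ hhi b (hG ▸ Ideal.subset_span hb)) e

end Saturation

section Generic

variable {K L : Type*} [Field K] [Field L] [Algebra K L] {k : Fin (n + 1)}

/-- The linear form in `x_0, …, x_k` with the given coefficients. -/
noncomputable def linForm (L : Type*) [Field L] [Algebra K L] {k : Fin (n + 1)} :
    ({i : Fin (n + 1) // i ≤ k} → K) →ₗ[K] Poly n L :=
  Fintype.linearCombination K fun l => X l.val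

theorem linForm_apply (a : {i : Fin (n + 1) // i ≤ k} → K) :
    linForm L a = ∑ l : {i : Fin (n + 1) // i ≤ k}, C (algebraMap K L (a l)) * X l.val := by
  rw [linForm, Fintype.linearCombination_apply]
  refine Finset.sum_congr rfl fun l _ => ?_
  rw [Algebra.smul_def]
  rfl

theorem isHomogeneous_linForm (a : {i : Fin (n + 1) // i ≤ k} → K) :
    (linForm L a : Poly n L).IsHomogeneous 1 := by
  rw [linForm_apply]
  exact IsHomogeneous.sum _ _ _ fun l _ => isHomogeneous_C_mul_X _ _

/-- A generic linear form in `x_0, …, x_k` is regular modulo the saturation of an ideal that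
contains powers of the other variables. -/
theorem exists_linForm_regular [Infinite K] {B : Ideal (Poly n L)}
    (hB : ∀ i, k < i → ∃ s, (X i : Poly n L) ^ s ∈ B)
    {W : Submodule K ({i : Fin (n + 1) // i ≤ k} → K)} (hW : W ≠ ⊤) :
    ∃ a ∉ W, ∀ f, linForm L a * f ∈ saturation B → f ∈ saturation B := by
  classical
  set M := Poly n L ⧸ saturation B
  have hfin := associatedPrimes.finite (Poly n L) M
  let V : Ideal (Poly n L) → Submodule K ({i : Fin (n + 1) // i ≤ k} → K) := fun p =>
    (p.restrictScalars K).comap (linForm L)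
  -- If all forms lay in `p`, then `p` would contain every variable (those beyond `x_k` through
  -- their powers), and its witness `f` would be zero modulo the saturation.
  have hV : ∀ p ∈ associatedPrimes (Poly n L) M, V p ≠ ⊤ := by
    intro p hp htop
    obtain ⟨hprime, x, hx⟩ := (isAssociatedPrime_iff).1 hp
    obtain ⟨f, rfl⟩ := Ideal.Quotient.mk_surjective x
    have hpmem : ∀ g, g ∈ p ↔ g * f ∈ saturation B := by
      intro g
      rw [hx, Submodule.mem_colon_singleton, Submodule.mem_bot, ← Ideal.Quotient.eq_zero_iff_mem,
        map_mul]
      rfl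
    have hX : ∀ i, (X i : Poly n L) ∈ p := by
      intro i
      by_cases hi : i ≤ k
      · have : (Pi.single ⟨i, hi⟩ 1 : {i : Fin (n + 1) // i ≤ k} → K) ∈ V p := htop ▸ trivial
        have h1 : linForm L (Pi.single ⟨i, hi⟩ 1 : {i : Fin (n + 1) // i ≤ k} → K) ∈ p := this
        rwa [linForm, Fintype.linearCombination_apply_single, one_smul] at h1
      · obtain ⟨s, hs⟩ := hB i (not_le.1 hi)
        refine hprime.mem_of_pow_mem s ((hpmem _).2 ?_)
        exact Ideal.mul_mem_right _ _ (le_saturation B hs)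
    refine hprime.ne_top ((Ideal.eq_top_iff_one _).2 ((hpmem 1).2 ?_))
    rw [one_mul]
    exact mem_saturation_of_X_mul_mem fun i => (hpmem _).1 (hX i)
  have hnot : ⊤ ∉ insert W (hfin.toFinset.image V) := by
    rw [Finset.mem_insert, Finset.mem_image]
    rintro (h | ⟨p, hp, h⟩)
    · exact hW h.symm
    · exact hV p (hfin.mem_toFinset.1 hp) h
  -- A vector space over the infinite field `K` is not a finite union of proper subspaces; this is
  -- why the coefficients can be taken in `K` although the primes live over `L`.
  have hne := Subspace.biUnion_ne_univ_of_top_notMem hnot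
  obtain ⟨a, ha⟩ := (Set.ne_univ_iff_exists_notMem _).1 hne
  have ha' : ∀ U ∈ insert W (hfin.toFinset.image V), a ∉ U := fun U hU hmem =>
    ha (Set.mem_biUnion hU hmem)
  refine ⟨a, ha' W (Finset.mem_insert_self _ _), fun f hf => ?_⟩
  by_contra hcon
  have hz : linForm L a ∈ {r : Poly n L | ∃ x : M, x ≠ 0 ∧ r • x = 0} :=
    ⟨Ideal.Quotient.mk _ f, fun h => hcon (Ideal.Quotient.eq_zero_iff_mem.1 h),
      Ideal.Quotient.eq_zero_iff_mem.2 hf⟩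
  rw [← biUnion_associatedPrimes_eq_zero_divisors] at hz
  obtain ⟨p, hp, hmem⟩ := Set.mem_iUnion₂.1 hz
  exact ha' (V p) (Finset.mem_insert_of_mem
    (Finset.mem_image_of_mem _ (hfin.mem_toFinset.2 hp))) hmem

/-- The form `y` is regular modulo `B` in degrees at least `d`. -/
def IsRegularFrom (B : Ideal (Poly n L)) (y : Poly n L) (d : ℕ) : Prop :=
  ∀ e ≥ d, ∀ f : Poly n L, f.IsHomogeneous e → y * f ∈ B → f ∈ B

theorem isHomogeneousIdeal_sup_span {J : Ideal (Poly n L)} (hJ : IsHomogeneousIdeal J)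
    {s : Set (Poly n L)} (hs : ∀ y ∈ s, y.IsHomogeneous 1) :
    IsHomogeneousIdeal (J ⊔ Ideal.span s) :=
  Ideal.IsHomogeneous.sup hJ (Ideal.homogeneous_span _ _ fun y hy => ⟨1, hs y hy⟩)

/-- Each new form is chosen outside the span of the earlier ones and regular modulo the saturation
of `B`, which agrees with `B` in large degrees. The bound `0` for `j = 0` is kept because it later
yields saturation of the initial ideal. -/
theorem exists_regular_sequence [Infinite K] {J : Ideal (Poly n L)} (hJ : IsHomogeneousIdeal J)
    (hJsat : IsSaturatedIdeal J) (hpow : ∀ i, k < i → ∃ s, (X i : Poly n L) ^ s ∈ J)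
    (m : ℕ) (hm : m ≤ k.val + 1) :
    ∃ v : ℕ → {i : Fin (n + 1) // i ≤ k} → K, LinearIndepOn K v (Set.Iio m) ∧
      ∀ j < m, ∃ d, (j = 0 → d = 0) ∧
        IsRegularFrom (J ⊔ Ideal.span ((fun i => linForm L (v i)) '' Set.Iio j))
          (linForm L (v j)) d := by
  classical
  induction m with
  | zero => exact ⟨0, by simp, by simp⟩
  | succ m ih =>
    obtain ⟨v, hv, hreg⟩ := ih (by omega)
    set B := J ⊔ Ideal.span ((fun i => linForm L (v i)) '' Set.Iio m) with hBdef
    have hB : IsHomogeneousIdeal B := isHomogeneousIdeal_sup_span hJ (by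
      rintro _ ⟨i, -, rfl⟩
      exact isHomogeneous_linForm _)
    -- Here `m ≤ k`, so `m` vectors cannot span a space of dimension `k + 1`.
    have hW : Submodule.span K (v '' Set.Iio m) ≠ ⊤ := by
      intro htop
      have h1 := finrank_span_le_card (R := K) (v '' Set.Iio m)
      have h2 : (v '' Set.Iio m).toFinset.card ≤ m := by
        rw [Set.toFinset_card, ← Nat.card_eq_fintype_card, Nat.card_coe_set_eq]
        refine (Set.ncard_image_le (Set.finite_Iio m)).trans ?_
        simp [Set.ncard_eq_toFinset_card']
      rw [htop, finrank_top, Module.finrank_fintype_fun_eq_card] at h1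
      have h3 : Fintype.card {i : Fin (n + 1) // i ≤ k} = k.val + 1 := by
        rw [Fintype.card_subtype, ← Fin.card_Iic]
        congr 1
        ext i
        simp
      omega
    obtain ⟨a, ha, hareg⟩ := exists_linForm_regular (L := L) (B := B)
      (fun i hi => let ⟨s, hs⟩ := hpow i hi; ⟨s, Ideal.mem_sup_left hs⟩) hW
    have heq : ∀ i < m, Function.update v m a i = v i := fun i hi =>
      Function.update_of_ne hi.ne _ _
    have himage : ∀ j ≤ m, (fun i => linForm L (Function.update v m a i)) '' Set.Iio j =
        (fun i => linForm L (v i) : ℕ → Poly n L) '' Set.Iio j := fun j hj =>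
      Set.image_congr fun i hi => by rw [heq i (lt_of_lt_of_le hi hj)]
    have himage' : Function.update v m a '' Set.Iio m = v '' Set.Iio m :=
      Set.image_congr fun i hi => heq i hi
    refine ⟨Function.update v m a, ?_, fun j hj => ?_⟩
    · have hins : Set.Iio (m + 1) = insert m (Set.Iio m) := by
        ext i
        simp
      rw [hins, linearIndepOn_insert (by simp), himage', Function.update_self]
      exact ⟨hv.congr fun i hi => (heq i hi).symm, ha⟩
    · rw [himage j (by omega)]
      rcases Nat.lt_succ_iff_lt_or_eq.1 hj with hjm | rfl
      · rw [heq j hjm]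
        exact hreg j hjm
      · rw [Function.update_self]
        obtain ⟨d, hd⟩ := exists_mem_of_mem_saturation hB
        by_cases hj0 : j = 0
        · refine ⟨0, fun _ => rfl, fun e _ f _ hf => ?_⟩
          have hBJ : B = J := by simp [hBdef, hj0]
          have := hareg f (le_saturation B hf)
          rw [← hBdef, hBJ]
          rw [hBJ] at this
          exact saturation_le_of_isSaturatedIdeal hJsat this
        · exact ⟨d, fun h => absurd h hj0, fun e he f hfe hf =>
            hd e he f (hareg f (le_saturation B hf)) hfe⟩

end Generic

/-! ### Generic coordinates -/

section Coordinates

variable {K L : Type*} [Field K] [Field L] [Algebra K L] {k : Fin (n + 1)}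

theorem coordChange_X_of_le (g : Matrix.GeneralLinearGroup {i : Fin (n + 1) // i ≤ k} K)
    {i : Fin (n + 1)} (hi : i ≤ k) : coordChange L g (X i) = linForm L (g.val ⟨i, hi⟩) := by
  rw [coordChange, aeval_X, dif_pos hi, linForm_apply]

theorem coordChange_X_of_lt (g : Matrix.GeneralLinearGroup {i : Fin (n + 1) // i ≤ k} K)
    {i : Fin (n + 1)} (hi : k < i) : coordChange L g (X i) = X i := by
  rw [coordChange, aeval_X, dif_neg (not_le.2 hi)]

theorem coordChange_comp (g h : Matrix.GeneralLinearGroup {i : Fin (n + 1) // i ≤ k} K)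
    (f : Poly n L) : coordChange L h (coordChange L g f) = coordChange L (g * h) f := by
  have : (coordChange L h).comp (coordChange L g) = coordChange L (g * h) := by
    refine algHom_ext fun i => ?_
    rw [AlgHom.comp_apply]
    by_cases hi : i ≤ k
    · rw [coordChange_X_of_le g hi, coordChange_X_of_le (g * h) hi, linForm_apply, map_sum]
      have : ∀ l : {i : Fin (n + 1) // i ≤ k}, coordChange L h
          (C (algebraMap K L (g.val ⟨i, hi⟩ l)) * X l.val) =
          g.val ⟨i, hi⟩ l • linForm L (h.val l) := fun l => by
        rw [map_mul, coordChange_X_of_le h l.2, Algebra.smul_def]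
        congr 1
        exact (coordChange L h).commutes _
      simp only [this]
      simp only [← map_smul]
      rw [← map_sum]
      congr 1
      ext l
      simp [Matrix.mul_apply]
    · rw [coordChange_X_of_lt g (not_le.1 hi), coordChange_X_of_lt h (not_le.1 hi),
        coordChange_X_of_lt (g * h) (not_le.1 hi)]
  exact DFunLike.congr_fun this f

theorem coordChange_one (f : Poly n L) :
    coordChange L (1 : Matrix.GeneralLinearGroup {i : Fin (n + 1) // i ≤ k} K) f = f := by
  have : coordChange L (1 : Matrix.GeneralLinearGroup {i : Fin (n + 1) // i ≤ k} K) =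
      AlgHom.id L (Poly n L) := by
    refine algHom_ext fun i => ?_
    by_cases hi : i ≤ k
    · rw [coordChange_X_of_le _ hi, linForm_apply,
        Finset.sum_eq_single_of_mem ⟨i, hi⟩ (Finset.mem_univ _)]
      · simp
      · intro l _ hl
        simp [Matrix.one_apply_ne hl.symm]
    · rw [coordChange_X_of_lt _ (not_le.1 hi), AlgHom.id_apply]
  rw [this, AlgHom.id_apply]

theorem IsHomogeneous.coordChange (g : Matrix.GeneralLinearGroup {i : Fin (n + 1) // i ≤ k} K)
    {f : Poly n L} {e : ℕ} (hf : f.IsHomogeneous e) :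
    (RelMarked.coordChange L g f).IsHomogeneous e := by
  rw [← one_mul e]
  refine MvPolynomial.IsHomogeneous.aeval hf _ fun i => ?_
  split_ifs with hi
  · rw [← linForm_apply]
    exact isHomogeneous_linForm _
  · exact isHomogeneous_X _ _

/-- The coordinate change `coordChange L g` as an automorphism. -/
noncomputable def coordEquiv (L : Type*) [Field L] [Algebra K L] {k : Fin (n + 1)}
    (g : Matrix.GeneralLinearGroup {i : Fin (n + 1) // i ≤ k} K) : Poly n L ≃ₐ[L] Poly n L :=
  AlgEquiv.ofAlgHom (coordChange L g) (coordChange L g⁻¹)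
    (AlgHom.ext fun f => by
      rw [AlgHom.comp_apply, coordChange_comp, inv_mul_cancel, coordChange_one, AlgHom.id_apply])
    (AlgHom.ext fun f => by
      rw [AlgHom.comp_apply, coordChange_comp, mul_inv_cancel, coordChange_one, AlgHom.id_apply])

theorem coordEquiv_apply (g : Matrix.GeneralLinearGroup {i : Fin (n + 1) // i ≤ k} K)
    (f : Poly n L) : coordEquiv L g f = coordChange L g f := rfl

theorem isHomogeneousIdeal_comap_coordEquiv {J : Ideal (Poly n L)} (hJ : IsHomogeneousIdeal J)
    (g : Matrix.GeneralLinearGroup {i : Fin (n + 1) // i ≤ k} K) :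
    IsHomogeneousIdeal (J.comap (coordEquiv L g)) := by
  rw [isHomogeneousIdeal_iff]
  intro f hf s
  have hcomm : coordEquiv L g (homogeneousComponent s f) =
      homogeneousComponent s (coordEquiv L g f) := by
    conv_rhs => rw [← sum_homogeneousComponent f]
    rw [map_sum, map_sum]
    have : ∀ i, homogeneousComponent s (coordEquiv L g (homogeneousComponent i f)) =
        if s = i then coordEquiv L g (homogeneousComponent i f) else 0 := fun i =>
      homogeneousComponent_of_mem (IsHomogeneous.coordChange g
        (homogeneousComponent_isHomogeneous i f))
    simp only [this]
    rw [Finset.sum_ite_eq]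
    split_ifs with hs
    · rfl
    · rw [homogeneousComponent_eq_zero s f (by simpa using hs), map_zero]
  rw [Ideal.mem_comap, hcomm]
  exact homogeneousComponent_mem_of_mem hJ hf s

/-- Every form of large degree already lies in `B`, by the pigeonhole principle on exponents. -/
theorem isRegularFrom_of_forall_pow_mem {B : Ideal (Poly n L)}
    (hB : ∀ i, ∃ s, (X i : Poly n L) ^ s ∈ B) (y : Poly n L) : ∃ d, IsRegularFrom B y d := by
  choose s hs using hB
  refine ⟨∑ i, s i + 1, fun e he f hf _ => ?_⟩
  rw [← support_sum_monomial_coeff f]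
  refine Ideal.sum_mem _ fun α hα => ?_
  have hdeg := isHomogeneous_iff_degree.1 hf α hα
  obtain ⟨i, hi⟩ : ∃ i, s i ≤ α i := by
    by_contra! hcon
    have := Finset.sum_le_sum (s := Finset.univ) fun i _ => (hcon i).le
    rw [← Finsupp.degree_eq_sum] at this
    omega
  have : monomial α (coeff α f) =
      monomial (α - Finsupp.single i (s i)) (coeff α f) * (X i : Poly n L) ^ s i := by
    rw [X_pow_eq_monomial, monomial_mul, mul_one,
      tsub_add_cancel_of_le (Finsupp.single_le_iff.2 hi)]
  rw [this]
  exact Ideal.mul_mem_left _ _ (hs i)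

/-- The rows of `g` are the generic forms, so pulling `J` back along `g` turns them into `x_0, …,
x_k`. For `j > k` regularity is automatic in large degrees, as the ideal contains a power of each
variable. -/
theorem exists_isRegularFrom_coordEquiv [Infinite K] {J : Ideal (Poly n L)}
    (hJ : IsHomogeneousIdeal J) (hJsat : IsSaturatedIdeal J)
    (hpow : ∀ i, k < i → ∃ s, (X i : Poly n L) ^ s ∈ J) :
    ∃ g : Matrix.GeneralLinearGroup {i : Fin (n + 1) // i ≤ k} K,
      ∀ j : Fin (n + 1), ∃ d, (j = 0 → d = 0) ∧
        IsRegularFrom (J.comap (coordEquiv L g) ⊔ Ideal.span (X '' Set.Iio j)) (X j) d := by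
  classical
  obtain ⟨v, hv, hreg⟩ := exists_regular_sequence (K := K) hJ hJsat hpow (k.val + 1) le_rfl
  set a : Matrix {i : Fin (n + 1) // i ≤ k} {i : Fin (n + 1) // i ≤ k} K :=
    fun i => v i.val.val with ha
  have hind : LinearIndependent K a.row := by
    let e : {i : Fin (n + 1) // i ≤ k} → Set.Iio (k.val + 1) := fun i =>
      ⟨i.val.val, Nat.lt_succ_of_le i.2⟩
    have he : Function.Injective e := fun i j h =>
      Subtype.ext (Fin.ext (congrArg Subtype.val h))
    exact LinearIndependent.comp hv e he
  set g : Matrix.GeneralLinearGroup {i : Fin (n + 1) // i ≤ k} K :=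
    (Matrix.linearIndependent_rows_iff_isUnit.1 hind).unit with hg
  have hgX : ∀ i ≤ k, coordEquiv L g (X i) = linForm L (k := k) (v i.val) := fun i hi =>
    coordChange_X_of_le g hi
  refine ⟨g, fun j => ?_⟩
  by_cases hj : j ≤ k
  · obtain ⟨d, hd0, hd⟩ := hreg j.val (Nat.lt_succ_of_le hj)
    refine ⟨d, fun h => hd0 (by simp [h]), fun e he f hf hXf => ?_⟩
    have himage : ((coordEquiv L g) '' (X '' Set.Iio j) : Set (Poly n L)) =
        (fun i => linForm L (k := k) (v i)) '' Set.Iio j.val := by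
      ext y
      constructor
      · rintro ⟨_, ⟨i, hi, rfl⟩, rfl⟩
        exact ⟨i.val, hi, (hgX i (le_of_lt (lt_of_lt_of_le hi hj))).symm⟩
      · rintro ⟨i, hi, rfl⟩
        have hij : i < n + 1 := lt_trans hi j.2
        have hij' : (⟨i, hij⟩ : Fin (n + 1)) < j := hi
        exact ⟨_, ⟨⟨i, hij⟩, hi, rfl⟩, hgX _ (hij'.le.trans hj)⟩
    have hmap : (J.comap (coordEquiv L g) ⊔ Ideal.span (X '' Set.Iio j)).map (coordEquiv L g) =
        J ⊔ Ideal.span ((fun i => linForm L (k := k) (v i)) '' Set.Iio j.val) := by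
      rw [Ideal.map_sup, Ideal.map_span, himage,
        Ideal.map_comap_of_surjective _ (coordEquiv L g).surjective]
    have hmem : ∀ x, coordEquiv L g x ∈ (J.comap (coordEquiv L g) ⊔
        Ideal.span (X '' Set.Iio j)).map (coordEquiv L g) →
        x ∈ J.comap (coordEquiv L g) ⊔ Ideal.span (X '' Set.Iio j) := by
      intro x hx
      obtain ⟨z, hz, hzx⟩ := (Ideal.mem_map_iff_of_surjective _ (coordEquiv L g).surjective).1 hx
      rwa [(coordEquiv L g).injective hzx] at hz
    refine hmem f ?_
    rw [hmap]
    refine hd e he _ (IsHomogeneous.coordChange g hf) ?_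
    have := Ideal.mem_map_of_mem (coordEquiv L g) hXf
    rwa [hmap, map_mul, hgX j hj] at this
  · have hkj := not_le.1 hj
    have hpow' : ∀ i, ∃ s, (X i : Poly n L) ^ s ∈
        J.comap (coordEquiv L g) ⊔ Ideal.span (X '' Set.Iio j) := by
      intro i
      by_cases hi : i ≤ k
      · refine ⟨1, ?_⟩
        rw [pow_one]
        exact Ideal.mem_sup_right (Ideal.subset_span ⟨i, lt_of_le_of_lt hi hkj, rfl⟩)
      · obtain ⟨s, hs⟩ := hpow i (not_le.1 hi)
        refine ⟨s, Ideal.mem_sup_left ?_⟩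
        rwa [Ideal.mem_comap, map_pow, coordEquiv_apply, coordChange_X_of_lt g (not_le.1 hi)]
    obtain ⟨d, hd⟩ := isRegularFrom_of_forall_pow_mem hpow' (X j)
    exact ⟨d, fun h => absurd (h ▸ Fin.zero_le k) hj, hd⟩

end Coordinates

/-! ### Regularity bounds the degrees of generators -/

section Regularity

variable {L : Type*} [Field L]

/-- Placed at `∅`, the form `f` is a Koszul cycle of homological degree `0`; the Betti number
vanishes in degree `s + 1`, so it is a boundary, and the singleton coefficients of a preimage are
the `c i`. -/
theorem exists_eq_sum_X_mul_of_reg_lt {J : Ideal (Poly n L)} {s : ℕ} (hs : reg J < (s + 1 : ℕ))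
    {f : Poly n L} (hf : f ∈ degPart J (s + 1)) :
    ∃ c : Fin (n + 1) → Poly n L, (∀ i, c i ∈ degPart J s) ∧ f = ∑ i, X i * c i := by
  classical
  have hB : ¬ BettiNonzero J 0 (s + 1) := by
    intro h
    refine absurd hs (not_lt.2 ?_)
    exact le_iSup_of_le 0 (le_iSup_of_le (s + 1) (le_iSup_of_le h le_rfl))
  rw [BettiNonzero, not_not] at hB
  set c : Finset (Fin (n + 1)) → Poly n L := Pi.single ∅ f with hc
  have hmem : c ∈ koszulChains J 0 (s + 1) ⊓ LinearMap.ker (koszulD n L) := by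
    refine ⟨fun B => ?_, ?_⟩
    · by_cases hB : B = ∅
      · subst hB
        rw [hc, Pi.single_eq_same]
        exact ⟨hf.1, fun α hα => ⟨rfl, isHomogeneous_iff_degree.1 hf.2 α (mem_support_iff.2 hα)⟩⟩
      · rw [hc, Pi.single_eq_of_ne hB]
        exact ⟨J.zero_mem, fun α hα => absurd (coeff_zero α) hα⟩
    · refine LinearMap.mem_ker.2 (funext fun B => ?_)
      refine Finset.sum_eq_zero fun a _ => ?_
      rw [hc, Pi.single_eq_of_ne (Finset.insert_ne_empty a B), mul_zero, mul_zero]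
  obtain ⟨c', hc', hd⟩ := hB hmem
  refine ⟨fun i => c' {i}, fun i => ⟨(hc' {i}).1, isHomogeneous_iff_degree.2 fun α hα => ?_⟩, ?_⟩
  · have := ((hc' {i}).2 α (mem_support_iff.1 hα)).2
    omega
  · have h1 := congrFun hd ∅
    rw [hc, Pi.single_eq_same] at h1
    rw [← h1]
    change ∑ a ∈ (∅ : Finset (Fin (n + 1)))ᶜ, _ = _
    rw [Finset.compl_empty]
    refine Finset.sum_congr rfl fun i _ => ?_
    simp

theorem truncGE_eq_span_degPart {J : Ideal (Poly n L)} {t : ℕ} (ht : reg J ≤ t) :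
    truncGE J t = Ideal.span (degPart J t) := by
  refine le_antisymm (Ideal.span_le.2 (Set.iUnion₂_subset fun s hs => ?_))
    (Ideal.span_mono (Set.subset_iUnion₂_of_subset t le_rfl subset_rfl))
  induction s, hs using Nat.le_induction with
  | base => exact Ideal.subset_span
  | succ s hs ih =>
    intro f hf
    obtain ⟨c, hc, rfl⟩ := exists_eq_sum_X_mul_of_reg_lt
      (lt_of_le_of_lt ht (by exact_mod_cast Nat.lt_succ_of_le hs)) hf
    exact Ideal.sum_mem _ fun i _ => Ideal.mul_mem_left _ _ (ih (hc i))

end Regularity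

/-! ### Relative marked bases from initial terms -/

section Decomposition

variable {K L : Type*} [Field K] [Field L] [Algebra K L]

/-- Splitting by terms in and outside `I` decomposes the ring; as `I` extends into `B`, it also
splits `B` into the extension of `I` and the part of `B` with normal support. This refines the
complement pair given by `B` and `N`. -/
theorem isGradedDecomposition_of_isMonomialIdeal {I : Ideal (Poly n K)} (hI : IsMonomialIdeal I)
    {B : Ideal (Poly n L)} (hB : IsHomogeneousIdeal B) (hIB : extend L I ≤ B) {N : Set (Term n)}
    (hdisj : ∀ f ∈ B, f ∈ restrictSupport L N → f = 0)
    (hsum : ∀ f, ∃ a ∈ B, ∃ r ∈ restrictSupport L N, f = a + r) :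
    IsGradedDecomposition ![(extend L I).restrictScalars L,
      restrictSupport L (normalTerms I) ⊓ B.restrictScalars L, restrictSupport L N] := by
  set M : Fin 3 → Submodule L (Poly n L) := ![(extend L I).restrictScalars L,
    restrictSupport L (normalTerms I) ⊓ B.restrictScalars L, restrictSupport L N] with hM
  have hdisj' : ∀ f ∈ extend L I, f ∈ restrictSupport L (normalTerms I) → f = 0 := by
    intro f hf hf'
    rw [← support_eq_empty, Finset.eq_empty_iff_forall_notMem]
    exact fun α hα => (mem_restrictSupport_iff L |>.1 hf') hα (hI.mem_extend_iff.1 hf α hα)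
  have hsum' : ∀ f : Poly n L, ∃ a ∈ extend L I, ∃ r ∈ restrictSupport L (normalTerms I),
      f = a + r := by
    classical
    intro f
    refine ⟨∑ α ∈ f.support with α ∈ termSet I, monomial α (coeff α f),
      Ideal.sum_mem _ fun α hα => ?_,
      ∑ α ∈ f.support with ¬ α ∈ termSet I, monomial α (coeff α f),
      Submodule.sum_mem _ fun α hα => ?_, ?_⟩
    · refine hI.mem_extend_iff.2 fun β hβ => ?_
      rw [Finset.mem_singleton.1 (support_monomial_subset hβ)]
      exact (Finset.mem_filter.1 hα).2
    · exact (monomial_mem_restrictSupport L).2 (Or.inl (Finset.mem_filter.1 hα).2)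
    · rw [Finset.sum_filter_add_sum_filter_not, support_sum_monomial_coeff]
  have hdecomp : ∀ f : Poly n L, ∃ a ∈ M 0, ∃ b ∈ M 1, ∃ c ∈ M 2, f = a + b + c := by
    intro f
    obtain ⟨u, hu, c, hc, rfl⟩ := hsum f
    obtain ⟨a, ha, b, hb, rfl⟩ := hsum' u
    exact ⟨a, ha, b, ⟨hb, by simpa using B.sub_mem hu (hIB ha)⟩, c, hc, rfl⟩
  refine ⟨?_, fun s => le_antisymm (iSup_le fun i => inf_le_right) fun f hf => ?_⟩
  · rw [DirectSum.isInternal_submodule_iff_iSupIndep_and_iSup_eq_top]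
    constructor
    · have hzero : ∀ a ∈ M 0, ∀ b ∈ M 1, ∀ c ∈ M 2, a + b + c = 0 → a = 0 ∧ b = 0 ∧ c = 0 := by
        intro a ha b hb c hc habc
        have hc0 : c = 0 := by
          refine hdisj c ?_ hc
          rw [eq_neg_of_add_eq_zero_right habc]
          exact B.neg_mem (B.add_mem (hIB ha) hb.2)
        rw [hc0, add_zero] at habc
        have ha0 : a = 0 := by
          refine hdisj' a ha ?_
          rw [eq_neg_of_add_eq_zero_left habc]
          exact Submodule.neg_mem _ hb.1
        rw [ha0, zero_add] at habc
        exact ⟨ha0, habc, hc0⟩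
      refine iSupIndep_fin_three.2 ⟨?_, ?_, ?_⟩
      · refine Submodule.disjoint_def.2 fun a ha ha' => ?_
        obtain ⟨b, hb, c, hc, hbc⟩ := Submodule.mem_sup.1 ha'
        exact (hzero a ha _ (neg_mem hb) _ (neg_mem hc) (by rw [← hbc]; abel)).1
      · refine Submodule.disjoint_def.2 fun b hb hb' => ?_
        obtain ⟨c, hc, a, ha, hca⟩ := Submodule.mem_sup.1 hb'
        exact (hzero _ (neg_mem ha) b hb _ (neg_mem hc) (by rw [← hca]; abel)).2.1
      · refine Submodule.disjoint_def.2 fun c hc hc' => ?_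
        obtain ⟨a, ha, b, hb, hab⟩ := Submodule.mem_sup.1 hc'
        exact (hzero _ (neg_mem ha) _ (neg_mem hb) c hc (by rw [← hab]; abel)).2.2
    · refine eq_top_iff.2 fun f _ => ?_
      obtain ⟨a, ha, b, hb, c, hc, rfl⟩ := hdecomp f
      exact Submodule.add_mem _ (Submodule.add_mem _ (Submodule.mem_iSup_of_mem 0 ha)
        (Submodule.mem_iSup_of_mem 1 hb)) (Submodule.mem_iSup_of_mem 2 hc)
  · obtain ⟨a, ha, b, hb, c, hc, rfl⟩ := hdecomp f
    have hself := homogeneousComponent_eq_self ((mem_homogeneousSubmodule _ _).1 hf)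
    rw [← hself, map_add, map_add]
    have hcomp : ∀ g : Poly n L, homogeneousComponent s g ∈
        homogeneousSubmodule (Fin (n + 1)) L s := fun g => homogeneousComponent_mem s g
    refine Submodule.add_mem _ (Submodule.add_mem _ (Submodule.mem_iSup_of_mem 0 ⟨?_, hcomp a⟩)
      (Submodule.mem_iSup_of_mem 1 ⟨⟨?_, ?_⟩, hcomp b⟩)) (Submodule.mem_iSup_of_mem 2 ⟨?_, hcomp c⟩)
    · refine hI.mem_extend_iff.2 fun α hα => hI.mem_extend_iff.1 ha α ?_
      rw [support_homogeneousComponent, Finset.mem_filter] at hα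
      exact hα.1
    · exact homogeneousComponent_mem_restrictSupport hb.1 s
    · exact homogeneousComponent_mem_of_mem hB hb.2 s
    · exact homogeneousComponent_mem_restrictSupport hc s

/-- The Pommaret bases of the truncations of `I` and of the ideal of the initial terms of `B`
carry a relative marked basis of the truncation of `B`. -/
theorem exists_isRelMarkedBasis {I J : Ideal (Poly n K)} (hI : IsMonomialIdeal I)
    (hJ : IsMonomialIdeal J) {B : Ideal (Poly n L)} (hB : IsHomogeneousIdeal B)
    (hIB : extend L I ≤ B) (hJB : termSet J = initTerms B) (hIJ : I ≤ J) {t : ℕ}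
    {P Q : Finset (Term n)} (hP : IsPommaretBasis P (truncGE I t))
    (hQ : IsPommaretBasis Q (truncGE J t)) :
    ∃ H : Set (Poly n L), IsRelMarkedBasis (truncGE I t) (truncGE J t) P Q H ∧
      genIdeal P H = truncGE B t := by
  classical
  have hF : ∀ α : Term n, ∃ f : Poly n L, α ∈ initTerms B → f ∈ B ∧ f.IsHomogeneous α.degree ∧
      coeff α f = 1 ∧ f - term L α ∈ restrictSupport L (initTerms B)ᶜ := by
    intro α
    by_cases hα : α ∈ initTerms B
    · obtain ⟨f, hf⟩ := exists_isHomogeneous_of_mem_initTerms hB hα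
      exact ⟨f, fun _ => hf⟩
    · exact ⟨0, fun h => absurd h hα⟩
  choose F hF using hF
  have hQmem : ∀ α ∈ Q, α ∈ initTerms B ∧ t ≤ α.degree := by
    intro α hα
    have : α ∈ termSet (truncGE J t) := hQ.span_eq ▸ Ideal.subset_span ⟨α, hα, rfl⟩
    rwa [hJ.termSet_truncGE, hJB] at this
  set H : Set (Poly n L) := F '' {α | α ∈ Q ∧ α ∉ P} with hH
  have hext : extend L (truncGE I t) = Ideal.span (term L '' (P : Set (Term n))) := by
    rw [← hP.span_eq, extend_span]
  have hextle : extend L (truncGE I t) ≤ genIdeal P H := by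
    rw [hext]
    exact Ideal.span_mono Set.subset_union_left
  have hle : genIdeal P H ≤ truncGE B t := by
    refine Ideal.span_le.2 (Set.union_subset ?_ ?_)
    · rintro _ ⟨α, hα, rfl⟩
      have : α ∈ termSet (truncGE I t) := hP.span_eq ▸ Ideal.subset_span ⟨α, hα, rfl⟩
      rw [hI.termSet_truncGE] at this
      refine (mem_truncGE_iff hB).2 ⟨hIB (hI.mem_extend_iff.2 fun β hβ => ?_), fun β hβ => ?_⟩
      · rw [Finset.mem_singleton.1 (support_monomial_subset hβ)]
        exact this.1
      · rw [Finset.mem_singleton.1 (support_monomial_subset hβ)]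
        exact this.2
    · rintro _ ⟨α, ⟨hα, -⟩, rfl⟩
      obtain ⟨hαB, hαt⟩ := hQmem α hα
      obtain ⟨h1, h2, -⟩ := hF α hαB
      refine (mem_truncGE_iff hB).2 ⟨h1, fun β hβ => ?_⟩
      rwa [isHomogeneous_iff_degree.1 h2 β hβ]
  -- Each term of the truncation is a multiple of some `u ∈ Q`, and `u` is the leading term of `x^u`
  -- or of `F u`, both available among the generators.
  have hinit : termSet (truncGE J t) ⊆ initTerms (genIdeal P H) := by
    intro α hα
    have hα' := hα
    rw [termSet, hQ.terms_eq] at hα'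
    obtain ⟨u, hu, δ, rfl, -⟩ := Set.mem_iUnion₂.1 hα'
    refine isUpperSet_initTerms _ (le_add_self : u ≤ δ + u) ?_
    by_cases huP : u ∈ P
    · exact mem_initTerms_of_term_mem (Ideal.subset_span (Or.inl ⟨u, huP, rfl⟩))
    · obtain ⟨h1, -, h2, h3⟩ := hF u (hQmem u hu).1
      refine ⟨F u, Ideal.subset_span (Or.inr ⟨u, ⟨hu, huP⟩, rfl⟩), ?_,
        degRevLex_degree_eq h1 h2 h3⟩
      intro h0
      rw [h0] at h2
      simp at h2
  have hdisj : ∀ f ∈ truncGE B t, f ∈ restrictSupport L (normalTerms (truncGE J t)) → f = 0 := by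
    intro f hf hf'
    by_contra h0
    rw [mem_truncGE_iff hB] at hf
    have hlead := (degRevLex n).degree_mem_support h0
    refine (mem_restrictSupport_iff L |>.1 hf') hlead ?_
    change (degRevLex n).degree f ∈ termSet (truncGE J t)
    rw [hJ.termSet_truncGE, hJB]
    exact ⟨⟨f, hf.1, h0, rfl⟩, hf.2 _ hlead⟩
  have hsum : ∀ f : Poly n L, ∃ a ∈ genIdeal P H,
      ∃ r ∈ restrictSupport L (normalTerms (truncGE J t)), f = a + r := by
    intro f
    obtain ⟨a, ha, r, hr, hf⟩ := exists_eq_add_of_initTerms (genIdeal P H) f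
    exact ⟨a, ha, r, restrictSupport_mono L (Set.compl_subset_compl.2 hinit) hr, hf⟩
  -- Reducing an element of the truncation of `B` by the smaller ideal leaves a remainder in that
  -- truncation with normal support, which is zero by `hdisj`.
  have heq : genIdeal P H = truncGE B t := by
    refine le_antisymm hle fun f hf => ?_
    obtain ⟨a, ha, r, hr, rfl⟩ := hsum f
    have hrB : r ∈ truncGE B t := by simpa using Ideal.sub_mem _ hf (hle ha)
    rwa [hdisj r hrB hr, add_zero]
  refine ⟨H, ⟨?_, hP, hQ, ⟨F, fun α hα => ?_, rfl⟩, ?_⟩, heq⟩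
  · exact Ideal.span_mono (Set.iUnion₂_mono fun s _ f hf => ⟨hIJ hf.1, hf.2⟩)
  · obtain ⟨hαB, -⟩ := hQmem α hα
    obtain ⟨-, h1, h2, h3⟩ := hF α hαB
    refine ⟨h1, h2, restrictSupport_mono L (Set.compl_subset_compl.2 fun β hβJ => ?_) h3⟩
    have : β ∈ termSet (truncGE J t) := hβJ
    rw [hJ.termSet_truncGE, hJB] at this
    exact this.1
  · refine isGradedDecomposition_of_isMonomialIdeal (hI.truncGE t) ?_ hextle ?_ hsum
    · rw [heq]
      exact hB.truncGE t
    · rwa [heq]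

end Decomposition

/-- Saturation need only be tested on powers of `x_0`, which can be cancelled one at a time on
supports. -/
theorem IsMonomialIdeal.isSaturatedIdeal {K : Type*} [Field K] {J : Ideal (Poly n K)}
    (hJ : IsMonomialIdeal J)
    (h : ∀ α : Term n, α + Finsupp.single 0 1 ∈ termSet J → α ∈ termSet J) :
    IsSaturatedIdeal J := by
  intro f s hf
  have hX : (X 0 : Poly n K) ^ s * f ∈ J :=
    hf _ (Ideal.pow_mem_pow (Ideal.subset_span (Set.mem_range_self 0)) s)
  clear hf
  induction s with
  | zero => simpa using hX
  | succ s ih =>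
    refine ih (hJ.mem_iff.2 fun α hα => h α (hJ _ hX _ ?_))
    rw [pow_succ', mul_assoc, mul_comm, mem_support_iff, coeff_mul_X]
    exact mem_support_iff.1 hα

/-! ### Truncations and generators under the coordinate change -/

section Transport

variable {K L : Type*} [Field K] [Field L] [Algebra K L] {k : Fin (n + 1)}

theorem truncGE_comap_coordEquiv (J : Ideal (Poly n L)) (t : ℕ)
    (g : Matrix.GeneralLinearGroup {i : Fin (n + 1) // i ≤ k} K) :
    truncGE (J.comap (coordEquiv L g)) t = (truncGE J t).map (coordEquiv L g).symm := by
  have hdeg : ∀ s, degPart (J.comap (coordEquiv L g)) s = (coordEquiv L g).symm '' degPart J s := by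
    intro s
    ext f
    constructor
    · rintro ⟨h1, h2⟩
      exact ⟨coordEquiv L g f, ⟨h1, IsHomogeneous.coordChange g h2⟩,
        (coordEquiv L g).symm_apply_apply f⟩
    · rintro ⟨f, ⟨h1, h2⟩, rfl⟩
      refine ⟨?_, IsHomogeneous.coordChange g⁻¹ h2⟩
      rwa [Ideal.mem_comap, AlgEquiv.apply_symm_apply]
  rw [truncGE, truncGE, Ideal.map_span, Set.image_iUnion₂]
  simp only [hdeg]

theorem span_inducedMap_image {I : Ideal (Poly n K)} (hI : IsQuasiStable I)
    (hk : IsLastFreeVar I k) (g : Matrix.GeneralLinearGroup {i : Fin (n + 1) // i ≤ k} K)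
    (D : Set (Poly n L)) :
    Ideal.span (inducedMap L hI hk g⁻¹ '' (Ideal.Quotient.mk (extend L I) '' D)) =
      ((Ideal.span D).map (coordEquiv L g).symm).map (Ideal.Quotient.mk (extend L I)) := by
  rw [Ideal.map_span, Ideal.map_span, Set.image_image, Set.image_image]
  rfl

end Transport

end RelMarked

/-! ### Assembly of the main theorem -/

theorem mainTheorem11 {n : ℕ} {K : Type*} [Field K] [Infinite K]
    (I : Ideal (RelMarked.Poly n K)) (hI : RelMarked.IsQuasiStable I)
    (hIsat : RelMarked.IsSaturatedIdeal I)
    (hCM : IsCohenMacaulayRing (RelMarked.Poly n K ⧸ I))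
    (k : Fin (n + 1)) (hk : RelMarked.IsLastFreeVar I k)
    {L : Type*} [Field L] [Algebra K L]
    (J : Ideal (RelMarked.Poly n L)) (hJ : RelMarked.IsHomogeneousIdeal J)
    (hJsat : RelMarked.IsSaturatedIdeal J) (hIJ : RelMarked.extend L I ≤ J)
    (t : ℕ) (ht : max (RelMarked.reg J) (RelMarked.reg I) ≤ t) :
    ∃ (g : Matrix.GeneralLinearGroup {i : Fin (n + 1) // i ≤ k} K)
      (J' : Ideal (RelMarked.Poly n K)),
      RelMarked.IsQuasiStable J' ∧ RelMarked.IsSaturatedIdeal J' ∧ I ≤ J' ∧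
      ∃ (P Q : Finset (RelMarked.Term n)) (H : Set (RelMarked.Poly n L)),
        RelMarked.IsRelMarkedBasis (RelMarked.truncGE I t) (RelMarked.truncGE J' t) P Q H ∧
        RelMarked.genIdeal P H ∈
          RelMarked.relMarkedFunctor L (RelMarked.truncGE I t) (RelMarked.truncGE J' t) ∧
        Ideal.span (RelMarked.inducedMap L hI hk g ''
            (Ideal.Quotient.mk (RelMarked.extend L I) '' RelMarked.degPart J t)) =
          Ideal.span (Ideal.Quotient.mk (RelMarked.extend L I) '' H) := by
  classical
  open RelMarked in
  have hmon := hI.isMonomialIdeal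
  have hpow : ∀ i, k < i → ∃ s, (X i : Poly n L) ^ s ∈ J := by
    intro i hi
    obtain ⟨s, hs⟩ := hk.exists_single_mem_termSet hI hCM hi
    refine ⟨s, hIJ (hmon.mem_extend_iff.2 fun α hα => ?_)⟩
    rw [X_pow_eq_monomial] at hα
    rwa [Finset.mem_singleton.1 (support_monomial_subset hα)]
  obtain ⟨g, hreg⟩ := exists_isRegularFrom_coordEquiv (K := K) hJ hJsat hpow
  set B := J.comap (coordEquiv L g) with hBdef
  have hB : IsHomogeneousIdeal B := isHomogeneousIdeal_comap_coordEquiv hJ g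
  have hIB : extend L I ≤ B := fun f hf => hIJ (extend_le_comap_coordChange L hI hk g hf)
  choose d hd0 hd using hreg
  have hstep : ∀ (α : Term n) (j : Fin (n + 1)), (∀ i < j, α i = 0) → d j ≤ α.degree →
      α + Finsupp.single j 1 ∈ initTerms B → α ∈ initTerms B := fun α j hα hdeg hmem =>
    isEventuallyStable_initTerms hB (fun f ⟨e, he, hfe⟩ hf => hd j e he f hfe hf) hα hdeg hmem
  have hstable : IsEventuallyStable (initTerms B) (Finset.univ.sup d) := fun α j hα hdeg hmem =>
    hstep α j hα ((Finset.le_sup (Finset.mem_univ j)).trans hdeg) hmem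
  -- Although `B` lives over `L`, its initial terms are combinatorial data and define a monomial
  -- ideal over `K`.
  set J' : Ideal (Poly n K) := restrictSupportIdeal K (initTerms B) (isUpperSet_initTerms B)
  have hJ'mon : IsMonomialIdeal J' := isMonomialIdeal_restrictSupportIdeal _
  have hJ'terms : termSet J' = initTerms B := termSet_restrictSupportIdeal _
  have hJ'stable : IsEventuallyStable (termSet J') (Finset.univ.sup d) := hJ'terms ▸ hstable
  have hIJ' : I ≤ J' := by
    intro f hf
    refine hJ'mon.mem_iff.2 fun α hα => ?_
    rw [hJ'terms]
    refine mem_initTerms_of_term_mem (hIB (hmon.mem_extend_iff.2 fun β hβ => ?_))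
    rw [Finset.mem_singleton.1 (support_monomial_subset hβ)]
    exact hmon f hf α hα
  obtain ⟨dI, hdI⟩ := hI.exists_isEventuallyStable
  obtain ⟨P, hP⟩ := hmon.exists_pommaretBasis_truncGE hdI t
  obtain ⟨Q, hQ⟩ := hJ'mon.exists_pommaretBasis_truncGE hJ'stable t
  obtain ⟨H, hH, hgen⟩ := exists_isRelMarkedBasis hmon hJ'mon hB hIB hJ'terms hIJ' hP hQ
  -- The inverse appears because `B` is the preimage of `J` under `g`, that is, its image under
  -- `g⁻¹`.
  refine ⟨g⁻¹, J', hJ'mon.exists_pommaretBasis hJ'stable, hJ'mon.isSaturatedIdeal ?_, hIJ', P, Q, H,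
    hH, ⟨P, Q, H, hH, rfl⟩, ?_⟩
  · intro α hα
    rw [hJ'terms] at hα ⊢
    exact hstep α 0 (fun i hi => absurd hi (Fin.not_lt_zero i)) (by simp [hd0 0 rfl]) hα
  · rw [span_inducedMap_image, ← truncGE_eq_span_degPart ((le_max_left _ _).trans ht),
      ← truncGE_comap_coordEquiv, ← hBdef, ← hgen, genIdeal, Ideal.span_union, Ideal.map_sup,
      Ideal.map_span _ H, sup_eq_right]
    -- The generators from `P` lie in the extension of `I`, so they vanish in the quotient and leave
    -- only `H`.
    have hPI : Ideal.span (term L '' (P : Set (Term n))) ≤ extend L I := by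
      refine Ideal.span_le.2 ?_
      rintro _ ⟨α, hα, rfl⟩
      have : α ∈ termSet (truncGE I t) := hP.span_eq ▸ Ideal.subset_span ⟨α, hα, rfl⟩
      rw [hmon.termSet_truncGE] at this
      refine hmon.mem_extend_iff.2 fun β hβ => ?_
      rw [Finset.mem_singleton.1 (support_monomial_subset hβ)]
      exact this.1
    rw [(Ideal.map_eq_bot_iff_le_ker _).2 (by rwa [Ideal.mk_ker])]
    exact bot_le
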